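/- Let $(\mathbf M,J,j)$ be a cocomplete involutive closed symmetric monoidal category: $\mathbf M$ is a cocomplete closed symmetric monoidal category with unit $I$, $J=(J,J_2,J_0):\mathbf M\to\mathbf M$ is a (lax) symmetric monoidal endofunctor and $j:\mathrm{Id}_{\mathbf M}\to J^2$ is a monoidal natural isomorphism with $jJ=Jj$. For a set $S$ write $S\otimes I:=\coprod_{s\in S} I$. Let $(\mathbf C,\perp)$ be an orthogonal category: $\mathbf C$ is a small category with set of objects $\mathbf C_0$, and $\perp$ is a symmetric relation on pairs of morphisms with common target which is stable under post-composition ($f_1\perp f_2\Rightarrow gf_1\perp gf_2$) and pre-composition ($f_1\perp f_2\Rightarrow f_1h_1\perp f_2h_2$). For a finite sequence $\underline c=(c_1,\dots,c_n)$ in $\mathbf C_0$ and $t\in\mathbf C_0$ set $$\mathcal O_{(\mathbf C,\perp)}\binom{t}{\underline c}:=\Big(\Sigma_n\times\prod_{i=1}^n\mathbf C(c_i,t)\Big)\Big/{\sim_\perp}\ \otimes\ I,$$ where $(\sigma,\underline f)\sim_\perp(\sigma',\underline f')$ if and only if $\underline f=\underline f'$ and the right permutation $\sigma\sigma'^{-1}:\underline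 f\sigma^{-1}\to\underline f\sigma'^{-1}$ is generated by transpositions of adjacent orthogonal pairs. Permutations act by $[\sigma,\underline f]\mapsto[\sigma\sigma',\underline f\sigma']$; the operadic composition $\gamma$ is induced by $$[\sigma,\underline f]\otimes\bigotimes_{i=1}^m[\sigma_i,\underline g_i]\longmapsto\big[\sigma(\sigma_1,\dots,\sigma_m),\underline f(\underline g_1,\dots,\underline g_m)\big],$$ where $\sigma(\sigma_1,\dots,\sigma_m)$ applies $\sigma_i$ inside the $i$-th block and then permutes the blocks by $\sigma$, and $\underline f(\underline g_1,\dots,\underline g_m)=(f_ig_{ij})_{i,j}$; the operadic unit $\mathbb 1:I\to\mathcal O_{(\mathbf C,\perp)}\binom tt$ is induced by $\bullet\mapsto[e,\mathrm{id}_t]$. Let $$*:\ \mathcal O_{(\mathbf C,\perp)}\binom{t}{\underline c}\longrightarrow J\,\mathcal O_{(\mathbf C,\perp)}\binom{t}{\underline c}$$ be the morphism whose composite with the inclusion of the summand $I$ belonging to $[\sigma,\underline f]$ is $J_0:I\to JI$ followed by $J$ applied to the inclusion of the summand belonging to $[\rho_n\sigma,\underline f]$, where $\rho_n\in\Sigma_n$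 is the order-reversal permutation. Then $(\mathcal O_{(\mathbf C,\perp)},\gamma,\mathbb 1,*)$ is a $\mathbf C_0$-colored $*$-operad with values in $(\mathbf M,J,j)$. That is, $(\mathcal O_{(\mathbf C,\perp)},\gamma,\mathbb 1)$ is a $\mathbf C_0$-colored (symmetric) operad in $\mathbf M$; $*$ is a morphism of symmetric sequences with $J(*)\circ *=j$; and $*$ is compatible with the operadic units, $*\circ\mathbb 1=J(\mathbb 1)\circ J_0$, and with the operadic compositions, $*\circ\gamma=J(\gamma)\circ J_2^m\circ\big(*\otimes\bigotimes_{i=1}^m *\big)$, where $J_2^m$ is the iterated structure morphism of the monoidal functor $J$. -/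

import Mathlib

open CategoryTheory MonoidalCategory Limits

universe w v u

namespace AQFT

/-! ### Involutive symmetric monoidal categories -/

/-- An involutive structure `(J, j)` on a symmetric monoidal category `M`: a (lax) symmetric
monoidal endofunctor `J` and a monoidal natural isomorphism `j : Id ≅ J²` with `j J = J j`. -/
structure Involution (M : Type u) [Category.{v} M] [MonoidalCategory M] [SymmetricCategory M] where
  J : M ⥤ M
  [laxBraided : J.LaxBraided]
  j : 𝟭 M ≅ J ⋙ J
  [isMonoidal : NatTrans.IsMonoidal j.hom]
  j_J : ∀ X : M, j.hom.app (J.obj X) = J.map (j.hom.app X)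

attribute [instance] Involution.laxBraided Involution.isMonoidal

/-! ### Profiles -/

/-- A `𝔠`-profile: a finite sequence of elements of `𝔠`. -/
structure Profile (𝔠 : Type w) : Type w where
  len : ℕ
  col : Fin len → 𝔠

namespace Profile

variable {𝔠 : Type w}

/-- A morphism `c ⟶ d` is a right permutation `σ` with `d = c σ`, i.e. `d i = c (σ i)`. -/
@[ext]
structure Hom (c d : Profile 𝔠) : Type where
  perm : Fin d.len ≃ Fin c.len
  col_perm : ∀ i, c.col (perm i) = d.col i

/-- The groupoid of profiles. The composite of `σ : c ⟶ c σ` and `τ : c σ ⟶ c σ τ` is `σ τ`. -/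
instance : Category (Profile 𝔠) where
  Hom := Hom
  id c := ⟨Equiv.refl _, fun _ => rfl⟩
  comp σ τ := ⟨τ.perm.trans σ.perm, fun i => (σ.col_perm _).trans (τ.col_perm i)⟩

theorem len_eq {c d : Profile 𝔠} (σ : c ⟶ d) : d.len = c.len := by
  simpa using Fintype.card_congr σ.perm

/-- The profile `(t)` of length one. -/
def single (t : 𝔠) : Profile 𝔠 := ⟨1, fun _ => t⟩

/-- The concatenation `b₁ ⊗ ⋯ ⊗ bₘ`; position `(i, j)` (the `j`-th entry of `bᵢ`) sits at
`finSigmaFinEquiv ⟨i, j⟩`, i.e. positions are ordered lexicographically. -/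
def concat {m : ℕ} (b : Fin m → Profile 𝔠) : Profile 𝔠 :=
  ⟨∑ i, (b i).len, fun k =>
    (b (finSigmaFinEquiv.symm k).1).col (finSigmaFinEquiv.symm k).2⟩

theorem concat_col {m : ℕ} (b : Fin m → Profile 𝔠) (x : (i : Fin m) × Fin (b i).len) :
    (concat b).col (finSigmaFinEquiv x) = (b x.1).col x.2 := by
  simp only [concat]
  rw [Equiv.symm_apply_apply]

/-- A bijection of positions `(i, j)` that respects colors, as a morphism of concatenations. -/
def concatHom {m n : ℕ} (b : Fin m → Profile 𝔠) (b' : Fin n → Profile 𝔠)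
    (e : ((i : Fin n) × Fin (b' i).len) ≃ ((i : Fin m) × Fin (b i).len))
    (h : ∀ x, (b (e x).1).col (e x).2 = (b' x.1).col x.2) : concat b ⟶ concat b' where
  perm := finSigmaFinEquiv.symm.trans (e.trans finSigmaFinEquiv)
  col_perm _ := (concat_col b _).trans (h _)

/-- The block sum `τ₁ ⊕ ⋯ ⊕ τₘ`. -/
def blockSum {m : ℕ} {b b' : Fin m → Profile 𝔠} (τ : ∀ i, b i ⟶ b' i) :
    concat b ⟶ concat b' :=
  concatHom b b' (Equiv.sigmaCongrRight fun i => (τ i).perm) fun x => (τ x.1).col_perm x.2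

/-- The block permutation `concat b ⟶ concat (b ∘ s)`, sending the position `(i, j)` of the
target to the position `(s i, j)` of the source. -/
def blockPerm {m n : ℕ} (b : Fin m → Profile 𝔠) (s : Fin n ≃ Fin m) :
    concat b ⟶ concat fun i => b (s i) :=
  concatHom b (fun i => b (s i)) (Equiv.sigmaCongrLeft (β := fun i => Fin (b i).len) s)
    fun _ => rfl

/-- The canonical (order-preserving) identification of the concatenation of the one-term
family `(c)` with `c`. -/
def concatOne (c : Profile 𝔠) : concat (fun _ : Fin 1 => c) ⟶ c where
  perm := (Equiv.uniqueSigma fun _ : Fin 1 => Fin c.len).symm.trans finSigmaFinEquiv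
  col_perm _ := concat_col (fun _ : Fin 1 => c) _

/-- The canonical (order-preserving) identification `(c₁) ⊗ ⋯ ⊗ (cₙ) = c`. -/
def concatSingle (c : Profile 𝔠) : concat (fun i => single (c.col i)) ⟶ c where
  perm := (Equiv.sigmaUnique (Fin c.len) fun _ => Fin 1).symm.trans finSigmaFinEquiv
  col_perm _ := concat_col (fun i => single (c.col i)) _

/-- The canonical (order-preserving) identification of the two ways of concatenating a doubly
indexed family: position `((i, j), l)` of the target is position `(i, (j, l))` of the source. -/
def concatAssoc {m : ℕ} (b : Fin m → Profile 𝔠) (c : ∀ i, Fin (b i).len → Profile 𝔠) :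
    concat (fun i => concat (c i)) ⟶
      concat (m := (concat b).len)
        (fun k => c (finSigmaFinEquiv.symm k).1 (finSigmaFinEquiv.symm k).2) :=
  concatHom _ _
    (((Equiv.sigmaCongrLeft (β := fun x : (i : Fin m) × Fin (b i).len => Fin (c x.1 x.2).len)
        finSigmaFinEquiv.symm).trans
      (Equiv.sigmaAssoc fun (i : Fin m) (j : Fin (b i).len) => Fin (c i j).len)).trans
      (Equiv.sigmaCongrRight fun _ => finSigmaFinEquiv))
    fun _ => concat_col (c _) ⟨_, _⟩

end Profile

/-! ### Finite tensor products in a symmetric monoidal category -/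

section Tensor

variable {M : Type u} [Category.{v} M] [MonoidalCategory M]

/-- The tensor product `X₁ ⊗ (X₂ ⊗ ( ⋯ (Xₙ ⊗ I)))`. -/
def tensorFin : (n : ℕ) → (Fin n → M) → M
  | 0, _ => 𝟙_ M
  | n + 1, X => X 0 ⊗ tensorFin n fun i => X i.succ

/-- Functoriality of the finite tensor product. -/
def tensorFinMap : (n : ℕ) → {X Y : Fin n → M} → (∀ i, X i ⟶ Y i) →
    (tensorFin n X ⟶ tensorFin n Y)
  | 0, _, _, _ => 𝟙 (𝟙_ M)
  | n + 1, _, _, f => f 0 ⊗ₘ tensorFinMap n fun i => f i.succ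

/-- The canonical morphism `I ⟶ I ⊗ ⋯ ⊗ I`. -/
def tensorFinUnit : (n : ℕ) → (𝟙_ M ⟶ tensorFin n fun _ => 𝟙_ M)
  | 0 => 𝟙 (𝟙_ M)
  | n + 1 => (λ_ (𝟙_ M)).inv ≫ (𝟙_ M ◁ tensorFinUnit n)

/-- The canonical isomorphism `(⨂ᵢ Aᵢ) ⊗ (⨂ⱼ Bⱼ) ⟶ ⨂ₖ Xₖ` for a concatenated family `X = (A, B)`. -/
def tensorFinAppend : (p q : ℕ) → {n : ℕ} → (h : p + q = n) → {A : Fin p → M} → {B : Fin q → M} →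
    {X : Fin n → M} → (∀ i, A i = X (Fin.cast h (Fin.castAdd q i))) →
    (∀ j, B j = X (Fin.cast h (Fin.natAdd p j))) → (tensorFin p A ⊗ tensorFin q B ⟶ tensorFin n X)
  | 0, q, n, h, A, B, X, _, hB => (λ_ (tensorFin q B)).hom ≫ eqToHom (by
      obtain rfl : q = n := by omega
      congr 1
      funext j
      rw [hB j]
      congr 1
      ext
      simp)
  | p + 1, q, 0, h, _, _, _, _, _ => False.elim (by omega)
  | p + 1, q, n + 1, h, A, B, X, hA, hB =>
      (α_ (A 0) (tensorFin p fun i => A i.succ) (tensorFin q B)).hom ≫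
        (eqToHom (hA 0) ⊗ₘ tensorFinAppend p q (by omega) (fun i => hA i.succ)
          (fun j => (hB j).trans (congrArg X (by ext; simp; omega))))

/-- The canonical isomorphism `⨂ᵢ ⨂ⱼ Z (i, j) ⟶ ⨂ₖ Z k` removing parentheses, where `k` runs
through all pairs `(i, j)` in lexicographic order. -/
def tensorFinFlatten : (m : ℕ) → (n : Fin m → ℕ) → (Z : ((i : Fin m) × Fin (n i)) → M) →
    (tensorFin m (fun i => tensorFin (n i) fun j => Z ⟨i, j⟩) ⟶
      tensorFin (∑ i, n i) fun k => Z (finSigmaFinEquiv.symm k))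
  | 0, _, _ => eqToHom (by rfl)
  | m + 1, n, Z =>
      (tensorFin (n 0) (fun j => Z ⟨0, j⟩) ◁
        tensorFinFlatten m (fun i => n i.succ) fun x => Z ⟨x.1.succ, x.2⟩) ≫
      tensorFinAppend (n 0) (∑ i : Fin m, n i.succ) (Fin.sum_univ_succ n).symm
        (fun j => congrArg Z (by
          rw [Equiv.eq_symm_apply]
          ext
          simp [finSigmaFinEquiv_apply]))
        (fun k => congrArg Z (by
          rw [Equiv.eq_symm_apply]
          obtain ⟨⟨i, j⟩, rfl⟩ := finSigmaFinEquiv.surjective k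
          rw [Equiv.symm_apply_apply]
          ext
          simp [finSigmaFinEquiv_apply, Fin.sum_univ_succ, add_assoc]))

variable [SymmetricCategory M]

/-- The canonical isomorphism `(⨂ᵢ Xᵢ) ⊗ (⨂ᵢ Yᵢ) ⟶ ⨂ᵢ (Xᵢ ⊗ Yᵢ)`. -/
def tensorFinInterleave : (n : ℕ) → (X Y : Fin n → M) →
    (tensorFin n X ⊗ tensorFin n Y ⟶ tensorFin n fun i => X i ⊗ Y i)
  | 0, _, _ => (λ_ (𝟙_ M)).hom
  | n + 1, X, Y =>
      tensorμ (X 0) (tensorFin n fun i => X i.succ) (Y 0) (tensorFin n fun i => Y i.succ) ≫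
        ((X 0 ⊗ Y 0) ◁ tensorFinInterleave n (fun i => X i.succ) fun i => Y i.succ)

/-- Pulling the `k`-th tensor factor to the front. -/
def tensorFinExtract : (n : ℕ) → (X : Fin (n + 1) → M) → (k : Fin (n + 1)) →
    (tensorFin (n + 1) X ⟶ X k ⊗ tensorFin n fun i => X (k.succAbove i))
  | 0, X, k => eqToHom (congrArg X (by omega)) ▷ 𝟙_ M
  | n + 1, X, k =>
    Fin.cases (motive := fun k => tensorFin (n + 2) X ⟶ X k ⊗ tensorFin (n + 1)
        fun i => X (k.succAbove i))
      (X 0 ◁ tensorFinMap (n + 1) fun i => eqToHom (congrArg X (Fin.zero_succAbove i).symm))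
      (fun k =>
        (X 0 ◁ tensorFinExtract n (fun i => X i.succ) k) ≫
        (α_ (X 0) (X k.succ) (tensorFin n fun i => X (k.succAbove i).succ)).inv ≫
        ((β_ (X 0) (X k.succ)).hom ▷ tensorFin n fun i => X (k.succAbove i).succ) ≫
        (α_ (X k.succ) (X 0) (tensorFin n fun i => X (k.succAbove i).succ)).hom ≫
        (X k.succ ◁ (eqToHom (congrArg X (by simp)) ⊗ₘ
          tensorFinMap n fun i => eqToHom (congrArg X (by simp)))))
      k

/-- The bijection `Fin m ≃ Fin n` which remains of `s : Fin (m + 1) ≃ Fin (n + 1)` when `0` and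
`s 0` are removed. -/
def equivRemoveZero {m n : ℕ} (s : Fin (m + 1) ≃ Fin (n + 1)) : Fin m ≃ Fin n :=
  ((finSuccAboveEquiv 0).trans
    (s.subtypeEquiv (p := fun i => i ≠ 0) (q := fun i => i ≠ s 0) fun i => by simp)).trans
    (finSuccAboveEquiv (s 0)).symm

theorem succAbove_equivRemoveZero {m n : ℕ} (s : Fin (m + 1) ≃ Fin (n + 1)) (i : Fin m) :
    (s 0).succAbove (equivRemoveZero s i) = s i.succ := by
  have h := (finSuccAboveEquiv (s 0)).apply_symm_apply
    (s.subtypeEquiv (p := fun i => i ≠ 0) (q := fun i => i ≠ s 0) (fun i => by simp)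
      (finSuccAboveEquiv 0 i))
  have h' := congrArg Subtype.val h
  rw [finSuccAboveEquiv_apply] at h'
  rw [← Fin.zero_succAbove i]
  exact h'

/-- The permutation of tensor factors `⨂ᵢ Xᵢ ⟶ ⨂ᵢ X (s i)` given by the symmetric braiding. -/
def tensorFinPerm : (m n : ℕ) → (X : Fin n → M) → (s : Fin m ≃ Fin n) →
    (tensorFin n X ⟶ tensorFin m fun i => X (s i))
  | 0, 0, _, _ => 𝟙 (𝟙_ M)
  | 0, _ + 1, _, s => (s.symm 0).elim0
  | _ + 1, 0, _, s => (s 0).elim0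
  | m + 1, n + 1, X, s =>
      tensorFinExtract n X (s 0) ≫
        (X (s 0) ◁ (tensorFinPerm m n (fun i => X ((s 0).succAbove i)) (equivRemoveZero s) ≫
          tensorFinMap m fun i => eqToHom (congrArg X (succAbove_equivRemoveZero s i))))

/-- The iterated structure morphism `J X₁ ⊗ ⋯ ⊗ J Xₙ ⟶ J (X₁ ⊗ ⋯ ⊗ Xₙ)`. -/
def tensorFinJ (J : M ⥤ M) [J.LaxMonoidal] : (n : ℕ) → (X : Fin n → M) →
    (tensorFin n (fun i => J.obj (X i)) ⟶ J.obj (tensorFin n X))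
  | 0, _ => Functor.LaxMonoidal.ε J
  | n + 1, X => (J.obj (X 0) ◁ tensorFinJ J n fun i => X i.succ) ≫
      Functor.LaxMonoidal.μ J (X 0) (tensorFin n fun i => X i.succ)

end Tensor

/-! ### Colored symmetric sequences, colored operads and colored `*`-operads -/

section Operad

variable (𝔠 : Type w) (M : Type u) [Category.{v} M]

/-- `𝔠`-colored symmetric sequences: functors `Σ_𝔠 × 𝔠 ⥤ M`, with `𝔠` regarded as a discrete
category. -/
abbrev SymSeq := Profile 𝔠 × Discrete 𝔠 ⥤ M

variable {𝔠 M}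

namespace SymSeq

/-- The value `X(t; c)`. -/
abbrev val (X : SymSeq 𝔠 M) (t : 𝔠) (c : Profile 𝔠) : M := X.obj (c, Discrete.mk t)

/-- The action `X(σ) : X(t; c) ⟶ X(t; c σ)` of a right permutation. -/
abbrev act (X : SymSeq 𝔠 M) (t : 𝔠) {c d : Profile 𝔠} (σ : c ⟶ d) : X.val t c ⟶ X.val t d :=
  X.map (Prod.mkHom σ (𝟙 (Discrete.mk t)))

/-- Change of color along an equality. -/
abbrev castCol (X : SymSeq 𝔠 M) {s t : 𝔠} (h : s = t) (c : Profile 𝔠) : X.val s c ⟶ X.val t c :=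
  eqToHom (congrArg (fun r => X.val r c) h)

end SymSeq

variable [MonoidalCategory M] [SymmetricCategory M]

/-- The data underlying a `𝔠`-colored operad: a symmetric sequence `X`, composition morphisms
`γ : X(t; a) ⊗ ⨂ᵢ X(aᵢ; bᵢ) ⟶ X(t; b₁ ⊗ ⋯ ⊗ bₘ)` and units `I ⟶ X(t; t)`. -/
structure OperadData (X : SymSeq 𝔠 M) where
  comp (t : 𝔠) (a : Profile 𝔠) (b : Fin a.len → Profile 𝔠) :
    X.val t a ⊗ tensorFin a.len (fun i => X.val (a.col i) (b i)) ⟶ X.val t (Profile.concat b)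
  unit (t : 𝔠) : 𝟙_ M ⟶ X.val t (Profile.single t)

/-- The axioms of a `𝔠`-colored operad: equivariance, unitality and associativity. The two
equivariance axioms say that the family `comp` is a family of morphisms out of the coend
`(X ∘ X)(t; c) = ∫^a ∫^b Σ_𝔠(b₁ ⊗ ⋯ ⊗ bₘ, c) ⊗ X(t; a) ⊗ ⨂ᵢ X(aᵢ; bᵢ)`, natural in `c`; the
remaining ones say that `X` is a monoid for the resulting circle product. -/
structure OperadData.IsOperad {X : SymSeq 𝔠 M} (P : OperadData X) : Prop where
  equivariant_inner (t : 𝔠) (a : Profile 𝔠) (b b' : Fin a.len → Profile 𝔠) (τ : ∀ i, b i ⟶ b' i) :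
    (X.val t a ◁ tensorFinMap a.len fun i => X.act (a.col i) (τ i)) ≫ P.comp t a b' =
      P.comp t a b ≫ X.act t (Profile.blockSum τ)
  equivariant_outer (t : 𝔠) {a a' : Profile 𝔠} (σ : a ⟶ a') (b : Fin a.len → Profile 𝔠) :
    (X.act t σ ⊗ₘ
      (tensorFinPerm a'.len a.len (fun i => X.val (a.col i) (b i)) σ.perm ≫
        tensorFinMap a'.len fun i => X.castCol (σ.col_perm i) (b (σ.perm i)))) ≫
      P.comp t a' (fun i => b (σ.perm i)) =
    P.comp t a b ≫ X.act t (Profile.blockPerm b σ.perm)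
  unit_comp (t : 𝔠) (c : Profile 𝔠) :
    (λ_ (X.val t c)).inv ≫ (P.unit t ⊗ₘ (ρ_ (X.val t c)).inv) ≫
      P.comp t (Profile.single t) (fun _ => c) ≫ X.act t (Profile.concatOne c) = 𝟙 (X.val t c)
  comp_unit (t : 𝔠) (c : Profile 𝔠) :
    (ρ_ (X.val t c)).inv ≫
      (X.val t c ◁ (tensorFinUnit c.len ≫ tensorFinMap c.len fun i => P.unit (c.col i))) ≫
      P.comp t c (fun i => Profile.single (c.col i)) ≫ X.act t (Profile.concatSingle c) =
    𝟙 (X.val t c)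
  assoc (t : 𝔠) (a : Profile 𝔠) (b : Fin a.len → Profile 𝔠)
      (c : ∀ i, Fin (b i).len → Profile 𝔠) :
    (α_ (X.val t a) (tensorFin a.len fun i => X.val (a.col i) (b i))
        (tensorFin a.len fun i => tensorFin (b i).len fun j => X.val ((b i).col j) (c i j))).inv ≫
      (P.comp t a b ⊗ₘ
        tensorFinFlatten a.len (fun i => (b i).len) fun x => X.val ((b x.1).col x.2) (c x.1 x.2)) ≫
      P.comp t (Profile.concat b)
        (fun k => c (finSigmaFinEquiv.symm k).1 (finSigmaFinEquiv.symm k).2) =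
    (X.val t a ◁
        (tensorFinInterleave a.len (fun i => X.val (a.col i) (b i))
            (fun i => tensorFin (b i).len fun j => X.val ((b i).col j) (c i j)) ≫
          tensorFinMap a.len fun i => P.comp (a.col i) (b i) (c i))) ≫
      P.comp t a (fun i => Profile.concat (c i)) ≫ X.act t (Profile.concatAssoc b c)

/-- The endofunctor `J_*` of the category of symmetric sequences, `X ↦ J X`. -/
abbrev Involution.JStar (Inv : Involution M) : SymSeq 𝔠 M ⥤ SymSeq 𝔠 M :=
  (Functor.whiskeringRight _ M M).obj Inv.J

/-- The natural isomorphism `j_* : Id ≅ J_*²`, with components `j X`. -/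
def Involution.jStar (Inv : Involution M) :
    𝟭 (SymSeq 𝔠 M) ≅ Inv.JStar ⋙ Inv.JStar :=
  NatIso.ofComponents (fun X => Functor.isoWhiskerLeft X Inv.j) (by
    intro X Y f
    ext x
    exact Inv.j.hom.naturality (f.app x))

/-- `(X, comp, unit)` together with `star : X ⟶ J_* X` is a colored `*`-operad: it is a colored
operad, `star` is a `*`-object in symmetric sequences, and `star` is compatible with
operadic units and compositions. -/
structure OperadData.IsStarOperad {X : SymSeq 𝔠 M} (P : OperadData X) (Inv : Involution M)
    (star : X ⟶ Inv.JStar.obj X) : Prop where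
  isOperad : P.IsOperad
  star_star : star ≫ Inv.JStar.map star = Inv.jStar.hom.app X
  unit_star (t : 𝔠) :
    P.unit t ≫ star.app (Profile.single t, Discrete.mk t) =
      Functor.LaxMonoidal.ε Inv.J ≫ Inv.J.map (P.unit t)
  comp_star (t : 𝔠) (a : Profile 𝔠) (b : Fin a.len → Profile 𝔠) :
    P.comp t a b ≫ star.app (Profile.concat b, Discrete.mk t) =
      (star.app (a, Discrete.mk t) ⊗ₘ
        tensorFinMap a.len fun i => star.app (b i, Discrete.mk (a.col i))) ≫
      (Inv.J.obj (X.val t a) ◁ tensorFinJ Inv.J a.len fun i => X.val (a.col i) (b i)) ≫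
      Functor.LaxMonoidal.μ Inv.J (X.val t a) (tensorFin a.len fun i => X.val (a.col i) (b i)) ≫
      Inv.J.map (P.comp t a b)

end Operad

/-! ### Orthogonal categories and the AQFT operad -/

/-- An orthogonality relation on a category. -/
structure Orthogonality (C : Type w) [Category.{w} C] where
  perp : ∀ {c₁ c₂ t : C}, (c₁ ⟶ t) → (c₂ ⟶ t) → Prop
  symm : ∀ {c₁ c₂ t : C} {f₁ : c₁ ⟶ t} {f₂ : c₂ ⟶ t}, perp f₁ f₂ → perp f₂ f₁
  postcomp : ∀ {c₁ c₂ t t' : C} {f₁ : c₁ ⟶ t} {f₂ : c₂ ⟶ t} (g : t ⟶ t'),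
    perp f₁ f₂ → perp (f₁ ≫ g) (f₂ ≫ g)
  precomp : ∀ {c₁ c₂ d₁ d₂ t : C} {f₁ : c₁ ⟶ t} {f₂ : c₂ ⟶ t} (h₁ : d₁ ⟶ c₁) (h₂ : d₂ ⟶ c₂),
    perp f₁ f₂ → perp (h₁ ≫ f₁) (h₂ ≫ f₂)

namespace Orthogonality

variable {C : Type w} [Category.{w} C] (O : Orthogonality C)

/-- `O.Generated g π`: the right permutation `π : g ⟶ g π` of a sequence `g` of morphisms with
common target is generated by transpositions of adjacent orthogonal pairs. -/
inductive Generated {n : ℕ} {t : C} {a : Fin n → C} (g : ∀ i, a i ⟶ t) :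
    Equiv.Perm (Fin n) → Prop
  | one : Generated g 1
  | mul_swap {π : Equiv.Perm (Fin n)} (h : Generated g π) (k l : Fin n)
      (hkl : (l : ℕ) = k + 1) (ho : O.perp (g (π k)) (g (π l))) :
      Generated g (π * Equiv.swap k l)

variable {O} in
theorem Generated.mul {n : ℕ} {t : C} {a : Fin n → C} {g : ∀ i, a i ⟶ t}
    {π π' : Equiv.Perm (Fin n)} (h : O.Generated g π)
    (h' : O.Generated (fun i => g (π i)) π') : O.Generated g (π * π') := by
  induction h' with
  | one => simpa using h
  | mul_swap _ k l hkl ho ih =>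
    rw [← mul_assoc]
    exact ih.mul_swap k l hkl ho

variable {O} in
theorem Generated.congr {n m : ℕ} {t : C} {a : Fin m → C} {g : ∀ i, a i ⟶ t} {p p' : Fin n → Fin m}
    {π : Equiv.Perm (Fin n)} (h : O.Generated (fun i => g (p i)) π) (hp : ∀ i, p i = p' i) :
    O.Generated (fun i => g (p' i)) π := by
  obtain rfl : p = p' := funext hp
  exact h

variable {O} in
theorem Generated.inv {n : ℕ} {t : C} {a : Fin n → C} {g : ∀ i, a i ⟶ t}
    {π : Equiv.Perm (Fin n)} (h : O.Generated g π) :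
    O.Generated (fun i => g (π i)) π⁻¹ := by
  induction h with
  | one => simpa using Generated.one
  | mul_swap h k l hkl ho ih =>
    rename_i π
    have h1 : O.Generated (fun i => g ((π * Equiv.swap k l) i)) (1 * Equiv.swap k l) :=
      Generated.one.mul_swap k l hkl (by
        have := O.symm ho
        simp only [Equiv.Perm.mul_apply, Equiv.Perm.one_apply]
        rwa [Equiv.swap_apply_left, Equiv.swap_apply_right])
    have h2 := h1.mul (π' := π⁻¹) (ih.congr fun i => by simp)
    simpa using h2

/-- The equivalence relation `∼_⊥` on `Σ_{|c|} × C(c, t)`. -/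
def setoid (c : Profile C) (t : C) : Setoid (Equiv.Perm (Fin c.len) × ∀ i, c.col i ⟶ t) where
  r x y := x.2 = y.2 ∧ O.Generated (fun i => x.2 (x.1⁻¹ i)) (x.1 * y.1⁻¹)
  iseqv :=
    { refl := fun x => ⟨rfl, by simpa using Generated.one⟩
      symm := by
        rintro ⟨σ, f⟩ ⟨τ, f'⟩ ⟨h1, h2⟩
        obtain rfl : f = f' := h1
        refine ⟨rfl, ?_⟩
        have := h2.inv.congr (g := f) (p' := fun i => τ⁻¹ i) fun i => by simp
        simpa using this
      trans := by
        rintro ⟨σ, f⟩ ⟨τ, f'⟩ ⟨υ, f''⟩ ⟨h1, h2⟩ ⟨h3, h4⟩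
        obtain rfl : f = f' := h1
        obtain rfl : f = f'' := h3
        refine ⟨rfl, ?_⟩
        have := h2.mul (π' := τ * υ⁻¹)
          (Generated.congr (g := f) h4 fun i => by simp)
        simpa [mul_assoc] using this }

/-- The set `(Σ_{|c|} × C(c, t)) / ∼_⊥`. -/
def Op (c : Profile C) (t : C) : Type w := Quotient (O.setoid c t)

/-- The equivalence class `[σ, f]`. -/
def cls {c : Profile C} {t : C} (σ : Equiv.Perm (Fin c.len)) (f : ∀ i, c.col i ⟶ t) : O.Op c t :=
  Quotient.mk (O.setoid c t) (σ, f)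

end Orthogonality

/-- `finSigmaFinEquiv` is the lexicographic order. -/
theorem finSigmaFinEquiv_lt_iff {m : ℕ} {n : Fin m → ℕ} (x y : (i : Fin m) × Fin (n i)) :
    finSigmaFinEquiv x < finSigmaFinEquiv y ↔
      x.1 < y.1 ∨ (x.1 = y.1 ∧ (x.2 : ℕ) < y.2) := by
  have key : ∀ z : (i : Fin m) × Fin (n i),
      (finSigmaFinEquiv z : ℕ) = ∑ i ∈ Finset.Iio z.1, n i + z.2 := by
    intro z
    rw [finSigmaFinEquiv_apply]
    congr 1
    refine Finset.sum_bij (fun i _ => Fin.castLE z.1.2.le i) ?_ ?_ ?_ ?_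
    · intro i _
      exact Finset.mem_Iio.mpr i.2
    · intro i _ j _ h
      exact Fin.castLE_injective _ h
    · intro i hi
      have hi' : i < z.1 := Finset.mem_Iio.mp hi
      exact ⟨⟨i, hi'⟩, Finset.mem_univ _, rfl⟩
    · intro i _
      rfl
  have mono : ∀ z w : (i : Fin m) × Fin (n i), z.1 < w.1 →
      (finSigmaFinEquiv z : ℕ) < finSigmaFinEquiv w := by
    intro z w h
    rw [key, key]
    have h1 : insert z.1 (Finset.Iio z.1) ⊆ Finset.Iio w.1 := by
      intro i hi
      simp only [Finset.mem_insert, Finset.mem_Iio] at hi ⊢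
      rcases hi with rfl | hi
      · exact h
      · exact hi.trans h
    have h2 := Finset.sum_le_sum_of_subset (f := n) h1
    rw [Finset.sum_insert (by simp)] at h2
    have := z.2.2
    omega
  constructor
  · intro h
    rcases lt_trichotomy x.1 y.1 with h1 | h1 | h1
    · exact Or.inl h1
    · right
      refine ⟨h1, ?_⟩
      have h' : (finSigmaFinEquiv x : ℕ) < finSigmaFinEquiv y := h
      rw [key, key] at h'
      have h2 : ∑ i ∈ Finset.Iio x.1, n i = ∑ i ∈ Finset.Iio y.1, n i := by rw [h1]
      omega
    · have := mono y x h1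
      have h' : (finSigmaFinEquiv x : ℕ) < finSigmaFinEquiv y := h
      omega
  · rintro (h | ⟨h1, h2⟩)
    · exact mono x y h
    · show (finSigmaFinEquiv x : ℕ) < finSigmaFinEquiv y
      rw [key, key]
      have h3 : ∑ i ∈ Finset.Iio x.1, n i = ∑ i ∈ Finset.Iio y.1, n i := by rw [h1]
      omega

namespace Orthogonality

variable {C : Type w} [Category.{w} C] (O : Orthogonality C)

/-- Two pairs `(σ, f)` and `(τ, f)` are equivalent if and only if any two entries that are ordered
differently by `σ` and `τ` are orthogonal. -/
theorem setoid_iff {c : Profile C} {t : C} (σ τ : Equiv.Perm (Fin c.len))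
    (f : ∀ i, c.col i ⟶ t) :
    O.setoid c t (σ, f) (τ, f) ↔ ∀ u v, σ u < σ v → τ v < τ u → O.perp (f u) (f v) := by
  constructor
  · rintro ⟨-, h⟩
    suffices H : ∀ π : Equiv.Perm (Fin c.len), O.Generated (fun i => f (σ⁻¹ i)) π →
        ∀ u v, σ u < σ v → (π⁻¹ * σ) v < (π⁻¹ * σ) u → O.perp (f u) (f v) by
      intro u v h1 h2
      refine H _ h u v h1 ?_
      simpa using h2
    intro π h
    induction h with
    | one =>
      intro u v h1 h2
      exact absurd h1 (by simpa using h2.le)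
    | @mul_swap π h k l hkl ho ih =>
      intro u v h1 h2
      by_cases h3 : (π⁻¹ * σ) v < (π⁻¹ * σ) u
      · exact ih u v h1 h3
      · have h4 : (π⁻¹ * σ) u < (π⁻¹ * σ) v := by
          refine lt_of_le_of_ne (not_lt.mp h3) fun h => ?_
          rw [(π⁻¹ * σ).injective h] at h1
          exact lt_irrefl _ h1
        have h5 : Equiv.swap k l ((π⁻¹ * σ) v) < Equiv.swap k l ((π⁻¹ * σ) u) := by
          simpa [mul_assoc] using h2
        have h6 : (π⁻¹ * σ) u = k ∧ (π⁻¹ * σ) v = l := by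
          generalize (π⁻¹ * σ) u = p at *
          generalize (π⁻¹ * σ) v = q at *
          rw [Equiv.swap_apply_def, Equiv.swap_apply_def] at h5
          split_ifs at h5 <;> simp only [Fin.ext_iff, Fin.lt_def] at * <;> omega
        have h7 : σ⁻¹ (π k) = u := by rw [← h6.1]; simp
        have h8 : σ⁻¹ (π l) = v := by rw [← h6.2]; simp
        rw [h7, h8] at ho
        exact ho
  · intro h
    induction hN : (Finset.univ.filter fun x : Fin c.len × Fin c.len =>
      σ x.1 < σ x.2 ∧ τ x.2 < τ x.1).card using Nat.strong_induction_on generalizing σ with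
    | _ N ih =>
    by_cases hex : ∃ u v, (σ v : ℕ) = σ u + 1 ∧ τ v < τ u
    · obtain ⟨u, v, huv, hτ⟩ := hex
      have hlt : σ u < σ v := by rw [Fin.lt_def]; omega
      have hsub : ∀ x y, (Equiv.swap (σ u) (σ v) * σ) x < (Equiv.swap (σ u) (σ v) * σ) y →
          τ y < τ x → σ x < σ y := by
        intro x y h1 h2
        by_contra h3
        have h4 : σ y < σ x := by
          refine lt_of_le_of_ne (not_lt.mp h3) fun h => ?_
          rw [σ.injective h] at h2
          exact lt_irrefl _ h2
        have h5 : σ y = σ u ∧ σ x = σ v := by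
          simp only [Equiv.Perm.mul_apply] at h1
          generalize σ u = k at *
          generalize σ v = l at *
          generalize σ x = p at *
          generalize σ y = q at *
          rw [Equiv.swap_apply_def, Equiv.swap_apply_def] at h1
          clear h ih hN
          split_ifs at h1 <;> simp only [Fin.ext_iff, Fin.lt_def] at * <;> omega
        rw [σ.injective h5.1, σ.injective h5.2] at h2
        exact lt_asymm h2 hτ
      have hperp := h u v hlt hτ
      refine (O.setoid c t).trans (b := (Equiv.swap (σ u) (σ v) * σ, f)) ⟨rfl, ?_⟩ ?_
      · have := Generated.mul_swap (O := O) (g := fun i => f (σ⁻¹ i)) Generated.one (σ u) (σ v) huv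
          (by
            have e : ∀ w, σ⁻¹ ((1 : Equiv.Perm (Fin c.len)) (σ w)) = w := by simp
            show O.perp (f _) (f _)
            rw [e, e]
            exact hperp)
        simpa using this
      · refine ih _ ?_ _ (fun x y h1 h2 => h x y (hsub x y h1 h2) h2) rfl
        rw [← hN]
        refine Finset.card_lt_card (Finset.ssubset_iff_of_subset ?_ |>.mpr ⟨(u, v), ?_, ?_⟩)
        · intro x hx
          simp only [Finset.mem_filter, Finset.mem_univ, true_and] at hx ⊢
          exact ⟨hsub _ _ hx.1 hx.2, hx.2⟩
        · simp [hlt, hτ]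
        · intro hx
          have h1 := (Finset.mem_filter.mp hx).2.1
          rw [Equiv.Perm.mul_apply, Equiv.Perm.mul_apply, Equiv.swap_apply_left,
            Equiv.swap_apply_right] at h1
          exact lt_asymm h1 hlt
    · push Not at hex
      have hmono : ∀ p q : Fin c.len, (q : ℕ) = p + 1 → τ (σ⁻¹ p) < τ (σ⁻¹ q) := by
        intro p q hpq
        refine lt_of_le_of_ne (hex (σ⁻¹ p) (σ⁻¹ q) (by simpa using hpq)) fun h => ?_
        have := σ⁻¹.injective (τ.injective h)
        rw [this] at hpq
        omega
      have hst : StrictMono (τ * σ⁻¹) := by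
        have : ∀ (d : ℕ) (p q : Fin c.len), (q : ℕ) = p + 1 + d → (τ * σ⁻¹) p < (τ * σ⁻¹) q := by
          intro d
          induction d with
          | zero => exact fun p q h => hmono p q h
          | succ d ihd =>
            intro p q h
            exact (ihd p ⟨p + 1 + d, by omega⟩ rfl).trans (hmono ⟨p + 1 + d, by omega⟩ q h)
        intro p q hpq
        exact this (q - p - 1) p q (by rw [Fin.lt_def] at hpq; omega)
      have hid : τ * σ⁻¹ = 1 := by
        ext i
        have := Subsingleton.elim (hst.orderIsoOfSurjective _ (τ * σ⁻¹).surjective)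
          (OrderIso.refl (Fin c.len))
        exact congrArg Fin.val (DFunLike.congr_fun this i)
      obtain rfl : τ = σ := by rwa [mul_inv_eq_one] at hid
      exact (O.setoid c t).refl _

theorem setoid_iff' {c : Profile C} {t : C} (x y : Equiv.Perm (Fin c.len) × ∀ i, c.col i ⟶ t) :
    O.setoid c t x y ↔
      x.2 = y.2 ∧ ∀ u v, x.1 u < x.1 v → y.1 v < y.1 u → O.perp (x.2 u) (x.2 v) := by
  obtain ⟨σ, f⟩ := x
  obtain ⟨τ, f'⟩ := y
  constructor
  · intro h
    obtain rfl : f = f' := h.1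
    exact ⟨rfl, (O.setoid_iff σ τ f).mp h⟩
  · rintro ⟨h, h'⟩
    obtain rfl : f = f' := h
    exact (O.setoid_iff σ τ f).mpr h'

/-- The action of `σ' : c ⟶ c σ'` (and of an equality `t = t'`) on representatives:
`(σ, f) ↦ (σ σ', f σ')`. -/
def actRep {c d : Profile C} {t t' : C} (s : c ⟶ d) (h : t = t')
    (x : Equiv.Perm (Fin c.len) × ∀ i, c.col i ⟶ t) :
    Equiv.Perm (Fin d.len) × ∀ i, d.col i ⟶ t' :=
  (s.perm.trans (x.1.trans (finCongr (Profile.len_eq s).symm)),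
    fun i => eqToHom (s.col_perm i).symm ≫ x.2 (s.perm i) ≫ eqToHom h)

/-- The action `[σ, f] ↦ [σ σ', f σ']`. -/
def act {c d : Profile C} {t t' : C} (s : c ⟶ d) (h : t = t') : O.Op c t → O.Op d t' :=
  Quotient.map (actRep s h) (by
    intro x y hxy
    subst h
    rw [← Quotient.eq_iff_equiv, Quotient.eq, setoid_iff'] at hxy ⊢
    refine ⟨?_, fun u v h1 h2 => ?_⟩
    · simp only [actRep, hxy.1]
    · exact O.precomp _ _ (by simpa [actRep] using hxy.2 (s.perm u) (s.perm v) h1 h2))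

/-- The map `[σ, f] ↦ [ρ σ, f]`, with `ρ` the order-reversal permutation. -/
def rev {c : Profile C} {t : C} : O.Op c t → O.Op c t :=
  Quotient.map (fun x => (Fin.revPerm * x.1, x.2)) (by
    intro x y hxy
    rw [← Quotient.eq_iff_equiv, Quotient.eq, setoid_iff'] at hxy ⊢
    refine ⟨hxy.1, fun u v h1 h2 => O.symm (hxy.2 v u ?_ ?_)⟩
    · simpa using h1
    · simpa using h2)

/-- The permutation `σ(τ₁, …, τₘ) = σ⟨|b_{σ⁻¹(1)}|, …, |b_{σ⁻¹(m)}|⟩ (τ₁ ⊕ ⋯ ⊕ τₘ)`. The block sum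
sends the position `(i, j)` to `(i, τᵢ j)`, and then the block permutation moves the `i`-th block
to the `σ i`-th place. -/
def compPerm {m : ℕ} (n : Fin m → ℕ) (σ : Equiv.Perm (Fin m)) (τ : ∀ i, Equiv.Perm (Fin (n i))) :
    Equiv.Perm (Fin (∑ i, n i)) :=
  (finSigmaFinEquiv.symm.trans
    (((Equiv.sigmaCongrRight τ).trans
      (Equiv.sigmaCongrLeft (β := fun i => Fin (n i)) σ⁻¹).symm).trans
      finSigmaFinEquiv)).trans
    (finCongr (Equiv.sum_comp σ⁻¹ n))

theorem compPerm_lt_iff {m : ℕ} (n : Fin m → ℕ) (σ : Equiv.Perm (Fin m))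
    (τ : ∀ i, Equiv.Perm (Fin (n i))) (x y : (i : Fin m) × Fin (n i)) :
    compPerm n σ τ (finSigmaFinEquiv x) < compPerm n σ τ (finSigmaFinEquiv y) ↔
      σ x.1 < σ y.1 ∨ (x.1 = y.1 ∧ (τ x.1 x.2 : ℕ) < τ y.1 y.2) := by
  have key : ∀ z : (i : Fin m) × Fin (n i),
      ((Equiv.sigmaCongrLeft (β := fun i => Fin (n i)) σ⁻¹).symm z).1 = σ z.1 ∧
      (((Equiv.sigmaCongrLeft (β := fun i => Fin (n i)) σ⁻¹).symm z).2 : ℕ) = z.2 := by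
    intro z
    obtain ⟨z, rfl⟩ := (Equiv.sigmaCongrLeft (β := fun i => Fin (n i)) σ⁻¹).surjective z
    rw [Equiv.symm_apply_apply]
    exact ⟨(σ.apply_symm_apply z.1).symm, rfl⟩
  have := finSigmaFinEquiv_lt_iff
    ((Equiv.sigmaCongrLeft (β := fun i => Fin (n i)) σ⁻¹).symm (Equiv.sigmaCongrRight τ x))
    ((Equiv.sigmaCongrLeft (β := fun i => Fin (n i)) σ⁻¹).symm (Equiv.sigmaCongrRight τ y))
  have e1 := (key (Equiv.sigmaCongrRight τ x)).1
  have e2 := (key (Equiv.sigmaCongrRight τ y)).1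
  have e3 := (key (Equiv.sigmaCongrRight τ x)).2
  have e4 := (key (Equiv.sigmaCongrRight τ y)).2
  have h := this.trans (or_congr (Eq.to_iff (congrArg₂ (· < ·) e1 e2))
    (and_congr ((Eq.to_iff (congrArg₂ (· = ·) e1 e2)).trans σ.injective.eq_iff)
      (Eq.to_iff (congrArg₂ (· < ·) e3 e4))))
  simp only [compPerm, Equiv.trans_apply, Equiv.symm_apply_apply]
  exact h

/-- Operadic composition on representatives:
`((σ, f), (σᵢ, gᵢ)ᵢ) ↦ (σ(σ₁, …, σₘ), f(g₁, …, gₘ))`. -/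
def compRep {t : C} {a : Profile C} {b : Fin a.len → Profile C}
    (x : Equiv.Perm (Fin a.len) × ∀ i, a.col i ⟶ t)
    (y : ∀ i, Equiv.Perm (Fin (b i).len) × ∀ j, (b i).col j ⟶ a.col i) :
    Equiv.Perm (Fin (Profile.concat b).len) × ∀ k, (Profile.concat b).col k ⟶ t :=
  (compPerm (fun i => (b i).len) x.1 fun i => (y i).1,
    fun k => (y (finSigmaFinEquiv.symm k).1).2 (finSigmaFinEquiv.symm k).2 ≫
      x.2 (finSigmaFinEquiv.symm k).1)

theorem compRep_congr {t : C} {a : Profile C} {b : Fin a.len → Profile C}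
    {x x' : Equiv.Perm (Fin a.len) × ∀ i, a.col i ⟶ t}
    {y y' : ∀ i, Equiv.Perm (Fin (b i).len) × ∀ j, (b i).col j ⟶ a.col i}
    (hx : O.setoid a t x x') (hy : ∀ i, O.setoid (b i) (a.col i) (y i) (y' i)) :
    O.setoid (Profile.concat b) t (compRep x y) (compRep x' y') := by
  simp only [setoid_iff'] at hx hy ⊢
  refine ⟨?_, fun (u v : Fin (∑ i, (b i).len)) h1 h2 => ?_⟩
  · simp only [compRep, hx.1, fun i => (hy i).1]
  · have h1' := (compPerm_lt_iff (fun i => (b i).len) x.1 (fun i => (y i).1)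
      (finSigmaFinEquiv.symm u) (finSigmaFinEquiv.symm v)).mp
        (by rw [Equiv.apply_symm_apply, Equiv.apply_symm_apply]; exact h1)
    have h2' := (compPerm_lt_iff (fun i => (b i).len) x'.1 (fun i => (y' i).1)
      (finSigmaFinEquiv.symm v) (finSigmaFinEquiv.symm u)).mp
        (by rw [Equiv.apply_symm_apply, Equiv.apply_symm_apply]; exact h2)
    suffices H : ∀ p q : (i : Fin a.len) × Fin (b i).len,
        (x.1 p.1 < x.1 q.1 ∨ (p.1 = q.1 ∧ ((y p.1).1 p.2 : ℕ) < (y q.1).1 q.2)) →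
        (x'.1 q.1 < x'.1 p.1 ∨ (q.1 = p.1 ∧ ((y' q.1).1 q.2 : ℕ) < (y' p.1).1 p.2)) →
        O.perp ((y p.1).2 p.2 ≫ x.2 p.1) ((y q.1).2 q.2 ≫ x.2 q.1) from H _ _ h1' h2'
    clear h1 h2 h1' h2'
    rintro ⟨i, j⟩ ⟨i', j'⟩ h1 h2
    by_cases hi : i = i'
    · subst hi
      exact O.postcomp _ ((hy i).2 j j' (by simpa using h1) (by simpa using h2))
    · refine O.precomp _ _ (hx.2 i i' ?_ ?_)
      · simpa [hi] using h1
      · simpa [Ne.symm hi] using h2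

/-- Operadic composition of sets,
`([σ, f], [σᵢ, gᵢ]ᵢ) ↦ [σ(σ₁, …, σₘ), f(g₁, …, gₘ)]`. -/
noncomputable def comp {t : C} {a : Profile C} {b : Fin a.len → Profile C} (x : O.Op a t)
    (y : ∀ i, O.Op (b i) (a.col i)) : O.Op (Profile.concat b) t :=
  Quotient.mk (O.setoid (Profile.concat b) t)
    (compRep (Quotient.out x) fun i => Quotient.out (y i))

/-- The composition is computed by arbitrary representatives. -/
theorem comp_mk {t : C} {a : Profile C} {b : Fin a.len → Profile C}
    (x : Equiv.Perm (Fin a.len) × ∀ i, a.col i ⟶ t)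
    (y : ∀ i, Equiv.Perm (Fin (b i).len) × ∀ j, (b i).col j ⟶ a.col i) :
    O.comp (Quotient.mk (O.setoid a t) x)
        (fun i => Quotient.mk (O.setoid (b i) (a.col i)) (y i)) =
      Quotient.mk (O.setoid (Profile.concat b) t) (compRep x y) :=
  Quotient.sound (O.compRep_congr (Quotient.mk_out (s := O.setoid a t) x)
    fun i => Quotient.mk_out (s := O.setoid (b i) (a.col i)) (y i))

end Orthogonality

/-! ### The AQFT operad with values in a symmetric monoidal category -/

section Copower

theorem unitor_aux {M : Type u} [Category.{v} M] [MonoidalCategory M] {A B D Z : M} (u : 𝟙_ M ⟶ A)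
    (v : A ⟶ B) (p : 𝟙_ M ⟶ D) (k : D ⊗ B ⟶ Z) (r : 𝟙_ M ⟶ Z) (h : (p ⊗ₘ (u ≫ v)) ≫ k = (ρ_ (𝟙_ M)).hom ≫ r) :
    ((λ_ (𝟙_ M)).inv ≫ (𝟙_ M ◁ u)) ≫ (p ⊗ₘ v) ≫ k = r := by
  have e : (𝟙_ M ◁ u) ≫ (p ⊗ₘ v) = p ⊗ₘ (u ≫ v) := by
    rw [← id_tensorHom, tensorHom_comp_tensorHom, Category.id_comp]
  rw [Category.assoc, reassoc_of% e, h, ← unitors_equal, Iso.inv_hom_id_assoc]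

variable {M : Type u} [Category.{v} M] [MonoidalCategory M] [MonoidalClosed M]
  [HasCoproducts.{w} M]

/-- The morphism `⨂ᵢ (Sᵢ ⊗ I) ⟶ Z` out of a finite tensor product of `Set`-tensorings, determined
by a family of morphisms `I ⟶ Z` indexed by `∏ᵢ Sᵢ`. (As `M` is closed, `⊗` preserves
coproducts, hence the source is `(∏ᵢ Sᵢ) ⊗ I`.) -/
noncomputable def tensorFinDesc : (n : ℕ) → (S : Fin n → Type w) → (Z : M) →
    ((∀ i, S i) → (𝟙_ M ⟶ Z)) →
    (tensorFin n (fun i => (sigmaConst.obj (𝟙_ M)).obj (S i)) ⟶ Z)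
  | 0, _, _, φ => φ fun i => i.elim0
  | n + 1, S, Z, φ =>
    MonoidalClosed.uncurry
      (tensorFinDesc n (fun i => S i.succ)
        ((ihom ((sigmaConst.obj (𝟙_ M)).obj (S 0))).obj Z) fun y =>
          MonoidalClosed.curry ((ρ_ ((sigmaConst.obj (𝟙_ M)).obj (S 0))).hom ≫
            Sigma.desc fun x => φ (Fin.cons x y)))

/-- The inclusion `I ⟶ S ⊗ I` belonging to an element of `S`. -/
noncomputable abbrev copowerι {S : Type w} (x : S) : 𝟙_ M ⟶ (sigmaConst.obj (𝟙_ M)).obj S :=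
  Sigma.ι (fun _ : S => 𝟙_ M) x

/-- Evaluating a morphism obtained by currying on `x ⊗ y`. -/
theorem copowerι_uncurry {S : Type w} {W Z : M} (x : S) (g : 𝟙_ M ⟶ W)
    (h : W ⟶ (ihom ((sigmaConst.obj (𝟙_ M)).obj S)).obj Z) (ψ : S → (𝟙_ M ⟶ Z))
    (hh : g ≫ h = MonoidalClosed.curry ((ρ_ ((sigmaConst.obj (𝟙_ M)).obj S)).hom ≫
      Sigma.desc fun x => ψ x)) :
    (copowerι x ⊗ₘ g) ≫ MonoidalClosed.uncurry h = (ρ_ (𝟙_ M)).hom ≫ ψ x := by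
  have h1 := congrArg MonoidalClosed.uncurry hh
  rw [MonoidalClosed.uncurry_natural_left, MonoidalClosed.uncurry_curry] at h1
  rw [MonoidalCategory.tensorHom_def, Category.assoc, h1, rightUnitor_naturality_assoc]
  congr 1
  exact Sigma.ι_desc _ _

/-- On elements, `tensorFinDesc` is given by the family which defines it. -/
theorem ι_tensorFinDesc : (n : ℕ) → (S : Fin n → Type w) → (Z : M) →
    (φ : (∀ i, S i) → (𝟙_ M ⟶ Z)) → (x : ∀ i, S i) →
    tensorFinUnit n ≫ tensorFinMap n (fun i => copowerι (x i)) ≫ tensorFinDesc n S Z φ = φ x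
  | 0, _, _, φ, x => by
    simp only [tensorFinUnit, tensorFinMap, tensorFinDesc]
    erw [Category.id_comp, Category.id_comp]
    congr 1
    funext i
    exact i.elim0
  | n + 1, S, Z, φ, x => by
    have ih := ι_tensorFinDesc n (fun i => S i.succ)
        ((ihom ((sigmaConst.obj (𝟙_ M)).obj (S 0))).obj Z) (fun y =>
          MonoidalClosed.curry ((ρ_ ((sigmaConst.obj (𝟙_ M)).obj (S 0))).hom ≫
            Sigma.desc fun x => φ (Fin.cons x y))) fun i => x i.succ
    have e : (Fin.cons (x 0) (fun i => x i.succ) : ∀ i, S i) = x := Fin.cons_self_tail x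
    have h := copowerι_uncurry (x 0) (tensorFinUnit n ≫
      tensorFinMap n fun i => copowerι (x i.succ)) _ (fun z => φ (Fin.cons z fun i => x i.succ))
      ((Category.assoc _ _ _).trans ih)
    rw [e] at h
    exact unitor_aux _ _ _ _ _ h

end Copower

namespace Orthogonality

variable {C : Type w} [Category.{w} C] (O : Orthogonality C)

theorem act_id {c : Profile C} {t : C} (x : O.Op c t) : O.act (𝟙 c) rfl x = x := by
  obtain ⟨⟨σ, f⟩, rfl⟩ := Quotient.exists_rep x
  simp only [act, Quotient.map_mk]
  congr 1
  refine Prod.ext ?_ ?_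
  · rfl
  · funext i
    exact (Category.id_comp _).trans (Category.comp_id _)

theorem act_comp {c d e : Profile C} {t t' t'' : C} (s : c ⟶ d) (s' : d ⟶ e) (h : t = t')
    (h' : t' = t'') (x : O.Op c t) :
    O.act (s ≫ s') (h.trans h') x = O.act s' h' (O.act s h x) := by
  obtain ⟨⟨σ, f⟩, rfl⟩ := Quotient.exists_rep x
  subst h h'
  simp only [act, Quotient.map_mk]
  congr 1
  refine Prod.ext ?_ ?_
  · rfl
  · funext i
    change eqToHom _ ≫ f _ ≫ eqToHom _ = eqToHom _ ≫ (eqToHom _ ≫ f _ ≫ eqToHom _) ≫ eqToHom _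
    simp only [eqToHom_refl, Category.comp_id]
    rw [eqToHom_trans_assoc]
    rfl

theorem rev_act {c d : Profile C} {t t' : C} (s : c ⟶ d) (h : t = t') (x : O.Op c t) :
    O.rev (O.act s h x) = O.act s h (O.rev x) := by
  obtain ⟨⟨σ, f⟩, rfl⟩ := Quotient.exists_rep x
  simp only [act, rev, Quotient.map_mk]
  congr 1
  refine Prod.ext ?_ rfl
  ext i
  have h := Profile.len_eq s
  have e : ∀ (n m : ℕ) (h : m = n) (k : Fin n),
      (Fin.rev (finCongr h.symm k) : ℕ) = finCongr h.symm (Fin.rev k) := by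
    intro n m h k
    subst h
    rfl
  exact e _ _ h _

/-- The functor `(c, t) ↦ (Σ_{|c|} × C(c, t)) / ∼_⊥` from `Σ_C × C` to sets. -/
def setSymSeq : Profile C × Discrete C ⥤ Type w where
  obj p := O.Op p.1 p.2.as
  map s := ↾(O.act s.1 (Discrete.eq_of_hom s.2))
  map_id p := by
    ext x
    exact O.act_id x
  map_comp s s' := by
    ext x
    exact O.act_comp s.1 s'.1 _ _ x

variable (M : Type u) [Category.{v} M] [MonoidalCategory M] [HasCoproducts.{w} M]

/-- The symmetric sequence `(c, t) ↦ (Σ_{|c|} × C(c, t)) / ∼_⊥ ⊗ I` underlying the AQFT operad. -/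
noncomputable def symSeq : SymSeq C M := O.setSymSeq ⋙ sigmaConst.obj (𝟙_ M)

/-- The inclusion `I ⟶ O(t; c)` belonging to the element `x = [σ, f]`. -/
noncomputable def ι {c : Profile C} {t : C} (x : O.Op c t) : 𝟙_ M ⟶ (O.symSeq M).val t c :=
  Sigma.ι (fun _ : O.Op c t => 𝟙_ M) x

variable {M} in
theorem ι_map {p q : Profile C × Discrete C} (s : p ⟶ q) (x : O.Op p.1 p.2.as) :
    O.ι M x ≫ (O.symSeq M).map s = O.ι M (O.act s.1 (Discrete.eq_of_hom s.2) x) :=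
  (Sigma.ι_comp_map' _ _ _).trans (Category.id_comp _)

/-- Operadic composition and unit of the AQFT operad, induced by the maps of sets
`([σ, f], [σᵢ, gᵢ]ᵢ) ↦ [σ(σ₁, …, σₘ), f(g₁, …, gₘ)]` and `• ↦ [e, id_t]`. -/
noncomputable def operad [SymmetricCategory M] [MonoidalClosed M] : OperadData (O.symSeq M) where
  comp t a b :=
    MonoidalClosed.uncurry
      (tensorFinDesc a.len (fun i => O.Op (b i) (a.col i))
        ((ihom ((O.symSeq M).val t a)).obj ((O.symSeq M).val t (Profile.concat b))) fun y =>
          MonoidalClosed.curry ((ρ_ ((O.symSeq M).val t a)).hom ≫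
            Sigma.desc fun x : O.Op a t => O.ι M (O.comp x y)))
  unit t := O.ι M (c := Profile.single t) (O.cls 1 fun _ => 𝟙 t)

/-- The composition of the AQFT operad is characterized by its values on elements. -/
theorem ι_operad_comp [SymmetricCategory M] [MonoidalClosed M] {t : C} {a : Profile C} {b : Fin a.len → Profile C}
    (x : O.Op a t) (y : ∀ i, O.Op (b i) (a.col i)) :
    (O.ι M x ⊗ₘ (tensorFinUnit a.len ≫ tensorFinMap a.len fun i => O.ι M (y i))) ≫
      (O.operad M).comp t a b = (ρ_ (𝟙_ M)).hom ≫ O.ι M (O.comp x y) :=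
  copowerι_uncurry x (tensorFinUnit a.len ≫ tensorFinMap a.len fun i => copowerι (y i)) _
    (fun x => O.ι M (O.comp x y))
    ((Category.assoc _ _ _).trans (ι_tensorFinDesc a.len _ _ _ y))

variable {M}

/-- The involution `O(t; c) ⟶ J O(t; c)`: it is induced by the map of sets
`[σ, f] ↦ [ρ σ, f]` and by `J₀ : I ⟶ J I`. -/
noncomputable def star [SymmetricCategory M] (Inv : Involution M) : O.symSeq M ⟶ Inv.JStar.obj (O.symSeq M) where
  app p := Sigma.desc fun x : O.Op p.1 p.2.as =>
    Functor.LaxMonoidal.ε Inv.J ≫ Inv.J.map (O.ι M (O.rev x))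
  naturality p q s := by
    refine Sigma.hom_ext _ _ fun (x : O.Op p.1 p.2.as) => ?_
    refine (Category.assoc _ _ _).symm.trans ((congrArg (· ≫ _) (O.ι_map s x)).trans ?_)
    refine (Sigma.ι_desc _ _).trans (Eq.trans ?_
      ((congrArg (fun g => g ≫ (Inv.JStar.obj (O.symSeq M)).map s)
        (Sigma.ι_desc (fun x : O.Op p.1 p.2.as =>
          Functor.LaxMonoidal.ε Inv.J ≫ Inv.J.map (O.ι M (O.rev x))) x).symm).trans
        (Category.assoc _ _ _)))
    rw [rev_act, ← O.ι_map s (O.rev x), Functor.map_comp, ← Category.assoc]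
    rfl

end Orthogonality

end AQFT

namespace AQFT

/-! ### Points of tensor products -/

section Points

/-! Every object in sight is built by tensoring coproducts of copies of `I`, so it can be treated as
if it had elements. A point of `A` is a morphism `I ⟶ A`. The summand inclusions of a coproduct of
copies of `I` are jointly epic. Since `M` is closed, tensoring preserves joint epicness
(`JointlyEpic.pointPair`, `JointlyEpic.tensorFinPoint`), so each axiom only has to be tested on
tensor products of points `ι x`.

Associators, braidings and all the finite-tensor isomorphisms send a tensor product of points to the
rebracketed or permuted tensor product of the same points. A lax monoidal `J` sends a point `p` to
`ε ≫ J p`, and `μ` is multiplicative on such points (`pointPair_μ`). Each axiom thereby becomes an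
identity between classes `[σ, f]` in the sets `O.Op c t`.

For these sets the useful view is that `σ` is a linear order on the positions: by `setoid_iff'`, two
representatives with the same morphisms are equivalent once every pair they order differently is
orthogonal. In particular, equal orders and equal morphisms suffice (`mk_eq_mk`). Composition is the
lexicographic order: blocks first, then entries within a block. Associativity is then the
associativity of lexicographic order, and compatibility of `*` with composition says that reversing
a lexicographic order reverses the blocks and the entries of each block. Finally `J(*) ∘ * = j`
combines `ρ ρ = e` with the naturality of `j` and its monoidality at `I`. -/

theorem comp_eqToHom_of_eq {M : Type u} [Category.{v} M] {ι : Type*} {X : ι → M} {W : M}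
    (u : ∀ i, W ⟶ X i) {i j : ι}
    (h : i = j) (e : X i = X j) : u i ≫ eqToHom e = u j := by
  subst h
  simp

variable {M : Type u} [Category.{v} M] [MonoidalCategory M]

/-- The point `I ≅ I ⊗ I ⟶ A ⊗ B` given by points of `A` and of `B`. -/
def pointPair {A B : M} (p : 𝟙_ M ⟶ A) (q : 𝟙_ M ⟶ B) : 𝟙_ M ⟶ A ⊗ B :=
  (λ_ (𝟙_ M)).inv ≫ (p ⊗ₘ q)

theorem pointPair_tensorHom {A B A' B' : M} (p : 𝟙_ M ⟶ A) (q : 𝟙_ M ⟶ B) (f : A ⟶ A')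
    (g : B ⟶ B') : pointPair p q ≫ (f ⊗ₘ g) = pointPair (p ≫ f) (q ≫ g) := by
  simp [pointPair]

theorem pointPair_whiskerLeft {A B B' : M} (p : 𝟙_ M ⟶ A) (q : 𝟙_ M ⟶ B) (g : B ⟶ B') :
    pointPair p q ≫ (A ◁ g) = pointPair p (q ≫ g) := by
  rw [← id_tensorHom, pointPair_tensorHom, Category.comp_id]

theorem pointPair_whiskerRight {A B A' : M} (p : 𝟙_ M ⟶ A) (q : 𝟙_ M ⟶ B) (f : A ⟶ A') :
    pointPair p q ≫ (f ▷ B) = pointPair (p ≫ f) q := by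
  rw [← tensorHom_id, pointPair_tensorHom, Category.comp_id]

theorem pointPair_id_left {B : M} (q : 𝟙_ M ⟶ B) : pointPair (𝟙 _) q = q ≫ (λ_ B).inv := by
  simp [pointPair]

theorem pointPair_id_right {A : M} (p : 𝟙_ M ⟶ A) : pointPair p (𝟙 _) = p ≫ (ρ_ A).inv := by
  simp [pointPair, unitors_inv_equal]

theorem pointPair_leftUnitor {B : M} (q : 𝟙_ M ⟶ B) : pointPair (𝟙 _) q ≫ (λ_ B).hom = q := by
  simp [pointPair_id_left]

theorem pointPair_associator {A B D : M} (p : 𝟙_ M ⟶ A) (q : 𝟙_ M ⟶ B) (r : 𝟙_ M ⟶ D) :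
    pointPair (pointPair p q) r ≫ (α_ A B D).hom = pointPair p (pointPair q r) := by
  -- By naturality it is enough to treat identity points, where the claim is a coherence between the
  -- unitors and the associator at `I`.
  have h : pointPair (pointPair p q) r = pointPair (pointPair (𝟙 _) (𝟙 _)) (𝟙 _) ≫
      ((p ⊗ₘ q) ⊗ₘ r) := by
    rw [pointPair_tensorHom, pointPair_tensorHom]
    simp
  have h' : pointPair p (pointPair q r) = pointPair (𝟙 _) (pointPair (𝟙 _) (𝟙 _)) ≫
      (p ⊗ₘ q ⊗ₘ r) := by
    rw [pointPair_tensorHom, pointPair_tensorHom]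
    simp
  rw [h, h', Category.assoc, associator_naturality, ← Category.assoc]
  congr 1
  simp only [pointPair_id_left, pointPair_id_right, Category.id_comp]
  rw [Category.assoc, ← whiskerLeft_rightUnitor_inv, ← unitors_inv_equal,
    leftUnitor_inv_naturality]

theorem pointPair_associator_inv {A B D : M} (p : 𝟙_ M ⟶ A) (q : 𝟙_ M ⟶ B) (r : 𝟙_ M ⟶ D) :
    pointPair p (pointPair q r) ≫ (α_ A B D).inv = pointPair (pointPair p q) r := by
  rw [← pointPair_associator, Category.assoc, Iso.hom_inv_id, Category.comp_id]

/-- Naturality moves the braiding to `I ⊗ I`, where it is the identity because the two unitors of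
`I` agree. -/
theorem pointPair_braiding [BraidedCategory M] {A B : M} (p : 𝟙_ M ⟶ A) (q : 𝟙_ M ⟶ B) :
    pointPair p q ≫ (β_ A B).hom = pointPair q p := by
  simp only [pointPair, Category.assoc, BraidedCategory.braiding_naturality]
  rw [← Category.assoc]
  congr 1
  rw [braiding_tensorUnit_left, unitors_equal]
  simp

theorem pointPair_tensorμ [BraidedCategory M] {A B D E : M} (p : 𝟙_ M ⟶ A) (q : 𝟙_ M ⟶ B)
    (r : 𝟙_ M ⟶ D) (s : 𝟙_ M ⟶ E) :
    pointPair (pointPair p q) (pointPair r s) ≫ tensorμ A B D E =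
      pointPair (pointPair p r) (pointPair q s) := by
  simp only [tensorμ]
  rw [← Category.assoc, pointPair_associator, ← Category.assoc, pointPair_whiskerLeft,
    pointPair_associator_inv, ← Category.assoc, pointPair_whiskerLeft, pointPair_whiskerRight,
    pointPair_braiding, ← Category.assoc, pointPair_whiskerLeft, pointPair_associator,
    pointPair_associator_inv]

/-- Naturality of `μ` reduces this to the pair `(ε, ε)`, and there it is the left unitality of `J`
at `I`. -/
theorem pointPair_μ (J : M ⥤ M) [J.LaxMonoidal] {A B : M} (p : 𝟙_ M ⟶ A) (q : 𝟙_ M ⟶ B) :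
    pointPair (Functor.LaxMonoidal.ε J ≫ J.map p) (Functor.LaxMonoidal.ε J ≫ J.map q) ≫
      Functor.LaxMonoidal.μ J A B = Functor.LaxMonoidal.ε J ≫ J.map (pointPair p q) := by
  rw [← pointPair_tensorHom, Category.assoc, Functor.LaxMonoidal.μ_natural]
  simp only [pointPair, Functor.map_comp]
  have h := Functor.LaxMonoidal.left_unitality_inv J (𝟙_ M)
  rw [← h, MonoidalCategory.tensorHom_def]
  simp only [MonoidalCategory.whiskerRight_id, Category.assoc]
  simp
  rw [← unitors_equal, Iso.inv_hom_id_assoc, unitors_inv_equal]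

/-- The point of a finite tensor product given by points of the factors. -/
def tensorFinPoint (n : ℕ) {X : Fin n → M} (u : ∀ i, 𝟙_ M ⟶ X i) : 𝟙_ M ⟶ tensorFin n X :=
  tensorFinUnit n ≫ tensorFinMap n u

theorem tensorFinPoint_zero {X : Fin 0 → M} (u : ∀ i, 𝟙_ M ⟶ X i) :
    tensorFinPoint 0 u = 𝟙 (𝟙_ M) :=
  Category.id_comp _

theorem tensorFinPoint_succ (n : ℕ) {X : Fin (n + 1) → M} (u : ∀ i, 𝟙_ M ⟶ X i) :
    tensorFinPoint (n + 1) u = pointPair (u 0) (tensorFinPoint n fun i => u i.succ) := by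
  have h := pointPair_tensorHom (𝟙 (𝟙_ M)) (tensorFinUnit n) (u 0)
    (tensorFinMap n fun i => u i.succ)
  rw [Category.id_comp, pointPair, id_tensorHom] at h
  exact h

theorem tensorFinPoint_map : (n : ℕ) → {X Y : Fin n → M} → (u : ∀ i, 𝟙_ M ⟶ X i) →
    (f : ∀ i, X i ⟶ Y i) →
    tensorFinPoint n u ≫ tensorFinMap n f = tensorFinPoint n fun i => u i ≫ f i
  | 0, _, _, u, f => by
    rw [tensorFinPoint_zero, tensorFinPoint_zero]
    exact Category.comp_id _
  | n + 1, _, _, u, f => by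
    rw [tensorFinPoint_succ, tensorFinPoint_succ, ← tensorFinPoint_map n]
    exact pointPair_tensorHom _ _ _ _

/-- The equality `e` of whole tensor products carries no information about factors, so the
comparison is supplied factor by factor. Once lengths and families are identified, `eqToHom e` is an
identity. -/
theorem tensorFinPoint_eqToHom {n n' : ℕ} {X : Fin n → M} {X' : Fin n' → M} (h : n = n')
    (u : ∀ i, 𝟙_ M ⟶ X i) (u' : ∀ i, 𝟙_ M ⟶ X' i) (hX : ∀ i, X i = X' (Fin.cast h i))
    (hu : ∀ i, u i ≫ eqToHom (hX i) = u' (Fin.cast h i)) (e : tensorFin n X = tensorFin n' X') :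
    tensorFinPoint n u ≫ eqToHom e = tensorFinPoint n' u' := by
  subst h
  obtain rfl : X = X' := funext hX
  obtain rfl : u = u' := funext fun i => by simpa using hu i
  simp

/-- The concatenated family of points `r` is a parameter tied to `u` and `v` by hypotheses, so the
induction only has to drop its first entry. -/
theorem tensorFinPoint_append : (p q : ℕ) → {n : ℕ} → (h : p + q = n) → {A : Fin p → M} →
    {B : Fin q → M} → {X : Fin n → M} → (hA : ∀ i, A i = X (Fin.cast h (Fin.castAdd q i))) →
    (hB : ∀ j, B j = X (Fin.cast h (Fin.natAdd p j))) → (u : ∀ i, 𝟙_ M ⟶ A i) →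
    (v : ∀ j, 𝟙_ M ⟶ B j) → (r : ∀ k, 𝟙_ M ⟶ X k) →
    (∀ i, u i ≫ eqToHom (hA i) = r (Fin.cast h (Fin.castAdd q i))) →
    (∀ j, v j ≫ eqToHom (hB j) = r (Fin.cast h (Fin.natAdd p j))) →
    pointPair (tensorFinPoint p u) (tensorFinPoint q v) ≫ tensorFinAppend p q h hA hB =
      tensorFinPoint n r
  | 0, q, n, h, A, B, X, hA, hB, u, v, r, hu, hv => by
    rw [tensorFinPoint_zero]
    simp only [tensorFinAppend]
    have e : ∀ j : Fin q, Fin.cast h (Fin.natAdd 0 j) = Fin.cast (by omega) j := fun j => by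
      ext
      simp
    refine (Category.assoc _ _ _).symm.trans
      ((congrArg (· ≫ _) (pointPair_leftUnitor _)).trans ?_)
    refine tensorFinPoint_eqToHom (by omega) v r
      (fun i => (hB i).trans (congrArg X (e i))) (fun i => ?_) _
    rw [← comp_eqToHom_of_eq r (e i) (congrArg X (e i)), ← hv, Category.assoc, eqToHom_trans]
  | p + 1, q, 0, h, _, _, _, _, _, _, _, _, _, _ => False.elim (by omega)
  | p + 1, q, n + 1, h, A, B, X, hA, hB, u, v, r, hu, hv => by
    have e : ∀ j : Fin q, Fin.cast h (Fin.natAdd (p + 1) j) =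
        (Fin.cast (by omega : p + q = n) (Fin.natAdd p j)).succ := fun j => by
      ext
      simp
      omega
    have ih := tensorFinPoint_append p q (n := n) (by omega) (fun i => hA i.succ)
      (fun j => (hB j).trans (congrArg X (e j))) (fun i => u i.succ) v (fun k => r k.succ)
      (fun i => hu i.succ) (fun j => by
        rw [← comp_eqToHom_of_eq r (e j) (congrArg X (e j)), ← hv, Category.assoc, eqToHom_trans])
    rw [tensorFinPoint_succ, tensorFinPoint_succ, ← ih]
    simp only [tensorFinAppend]
    refine (Category.assoc _ _ _).symm.trans
      ((congrArg (· ≫ _) (pointPair_associator _ _ _)).trans ?_)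
    refine (pointPair_tensorHom _ _ _ _).trans ?_
    congr 1
    exact hu 0

theorem tensorFinPoint_flatten : (m : ℕ) → (n : Fin m → ℕ) →
    (Z : ((i : Fin m) × Fin (n i)) → M) → (u : ∀ x, 𝟙_ M ⟶ Z x) →
    tensorFinPoint m (fun i => tensorFinPoint (n i) fun j => u ⟨i, j⟩) ≫ tensorFinFlatten m n Z =
      tensorFinPoint (∑ i, n i) fun k => u (finSigmaFinEquiv.symm k)
  | 0, n, Z, u => by
    rw [tensorFinPoint_zero]
    rfl
  | m + 1, n, Z, u => by
    rw [tensorFinPoint_succ]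
    simp only [tensorFinFlatten]
    refine (Category.assoc _ _ _).symm.trans
      ((congrArg (· ≫ _) (pointPair_whiskerLeft _ _ _)).trans ?_)
    rw [tensorFinPoint_flatten m (fun i => n i.succ) (fun x => Z ⟨x.1.succ, x.2⟩)
      (fun x => u ⟨x.1.succ, x.2⟩)]
    refine tensorFinPoint_append _ _ _ _ _ _ _ _ (fun i => ?_) (fun k => ?_)
    -- In lexicographic numbering the entries of block `0` come first; those of the later blocks
    -- follow, shifted by `n 0`.
    · exact comp_eqToHom_of_eq (X := Z) u (i := ⟨0, i⟩) (by
          rw [Equiv.eq_symm_apply]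
          ext
          simp [finSigmaFinEquiv_apply]) _
    · exact comp_eqToHom_of_eq (X := Z) u (i := ⟨(finSigmaFinEquiv.symm k).1.succ, _⟩) (by
          rw [Equiv.eq_symm_apply]
          obtain ⟨⟨i, j⟩, rfl⟩ := finSigmaFinEquiv.surjective k
          rw [Equiv.symm_apply_apply]
          ext
          simp [finSigmaFinEquiv_apply, Fin.sum_univ_succ, add_assoc]) _

/-! ### Points under interleaving and permutation of tensor factors. -/

variable [SymmetricCategory M]

theorem tensorFinPoint_interleave : (n : ℕ) → {X Y : Fin n → M} → (u : ∀ i, 𝟙_ M ⟶ X i) →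
    (v : ∀ i, 𝟙_ M ⟶ Y i) →
    pointPair (tensorFinPoint n u) (tensorFinPoint n v) ≫ tensorFinInterleave n X Y =
      tensorFinPoint n fun i => pointPair (u i) (v i)
  | 0, X, Y, u, v => by
    rw [tensorFinPoint_zero, tensorFinPoint_zero, tensorFinPoint_zero]
    exact pointPair_leftUnitor _
  | n + 1, X, Y, u, v => by
    rw [tensorFinPoint_succ, tensorFinPoint_succ, tensorFinPoint_succ,
      ← tensorFinPoint_interleave n]
    simp only [tensorFinInterleave]
    refine (Category.assoc _ _ _).symm.trans
      ((congrArg (· ≫ _) (pointPair_tensorμ _ _ _ _)).trans ?_)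
    exact pointPair_whiskerLeft _ _ _

theorem tensorFinPoint_extract : (n : ℕ) → {X : Fin (n + 1) → M} → (u : ∀ i, 𝟙_ M ⟶ X i) →
    (k : Fin (n + 1)) →
    tensorFinPoint (n + 1) u ≫ tensorFinExtract n X k =
      pointPair (u k) (tensorFinPoint n fun i => u (k.succAbove i))
  | 0, X, u, k => by
    obtain rfl : k = 0 := by omega
    rw [tensorFinPoint_succ, tensorFinPoint_zero, tensorFinPoint_zero]
    simp only [tensorFinExtract]
    refine (pointPair_whiskerRight _ _ _).trans ?_
    simp
  | n + 1, X, u, k => by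
    induction k using Fin.cases with
    | zero =>
      rw [tensorFinPoint_succ]
      simp only [tensorFinExtract]
      refine (pointPair_whiskerLeft _ _ _).trans ?_
      rw [tensorFinPoint_map]
      congr 2
      funext i
      exact comp_eqToHom_of_eq u (Fin.zero_succAbove i).symm _
    | succ k =>
      rw [tensorFinPoint_succ]
      simp only [tensorFinExtract]
      refine (Category.assoc _ _ _).symm.trans
        ((congrArg (· ≫ _) (pointPair_whiskerLeft _ _ _)).trans ?_)
      -- The chosen point is first pulled to the front of the tail and then braided past the point
      -- `u 0`.
      rw [tensorFinPoint_extract n (fun i => u i.succ) k]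
      refine (Category.assoc _ _ _).symm.trans
        ((congrArg (· ≫ _) (pointPair_associator_inv _ _ _)).trans ?_)
      refine (Category.assoc _ _ _).symm.trans
        ((congrArg (· ≫ _) ((pointPair_whiskerRight _ _ _).trans
          (congrArg (pointPair · _) (pointPair_braiding _ _)))).trans ?_)
      refine (Category.assoc _ _ _).symm.trans
        ((congrArg (· ≫ _) (pointPair_associator _ _ _)).trans ?_)
      refine (pointPair_whiskerLeft _ _ _).trans ?_
      congr 1
      refine (pointPair_tensorHom _ _ _ _).trans ?_
      rw [tensorFinPoint_map, tensorFinPoint_succ]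
      congr 1
      · exact comp_eqToHom_of_eq u (by simp) _
      · congr 1
        funext i
        exact comp_eqToHom_of_eq u (i := (k.succAbove i).succ) (by simp) _

theorem tensorFinPoint_perm : (m n : ℕ) → {X : Fin n → M} → (u : ∀ i, 𝟙_ M ⟶ X i) →
    (s : Fin m ≃ Fin n) →
    tensorFinPoint n u ≫ tensorFinPerm m n X s = tensorFinPoint m fun i => u (s i)
  | 0, 0, _, u, _ => by
    rw [tensorFinPoint_zero, tensorFinPoint_zero]
    exact Category.id_comp _
  | 0, _ + 1, _, _, s => (s.symm 0).elim0
  | _ + 1, 0, _, _, s => (s 0).elim0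
  | m + 1, n + 1, X, u, s => by
    simp only [tensorFinPerm]
    refine (Category.assoc _ _ _).symm.trans
      ((congrArg (· ≫ _) (tensorFinPoint_extract _ _ _)).trans ?_)
    refine (pointPair_whiskerLeft _ _ _).trans ?_
    rw [← Category.assoc, tensorFinPoint_perm m n (fun i => u ((s 0).succAbove i)),
      tensorFinPoint_map, tensorFinPoint_succ]
    congr 2
    funext i
    exact comp_eqToHom_of_eq u (succAbove_equivRemoveZero s i) _

end Points

/-- The positions of a concatenation. -/
def Profile.concatPos {𝔠 : Type w} {m : ℕ} (b : Fin m → Profile 𝔠) :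
    ((i : Fin m) × Fin (b i).len) ≃ Fin (Profile.concat b).len :=
  finSigmaFinEquiv

/-- `concatHom` is `e` conjugated by the lexicographic numberings, so on numbered positions only `e`
remains. -/
theorem Profile.concatHom_perm {𝔠 : Type w} {m n : ℕ} (b : Fin m → Profile 𝔠)
    (b' : Fin n → Profile 𝔠) (e : ((i : Fin n) × Fin (b' i).len) ≃ ((i : Fin m) × Fin (b i).len))
    (h : ∀ x, (b (e x).1).col (e x).2 = (b' x.1).col x.2) (x : (i : Fin n) × Fin (b' i).len) :
    (Profile.concatHom b b' e h).perm (Profile.concatPos b' x) = Profile.concatPos b (e x) :=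
  congrArg (fun y => Profile.concatPos b (e y)) (Equiv.symm_apply_apply (Profile.concatPos b') x)

/-! ### The operad of sets `(Σ_{|c|} × C(c, t)) / ∼_⊥` -/

namespace Orthogonality

variable {C : Type w} [Category.{w} C] (O : Orthogonality C)

/-- Color bookkeeping: the left side has the shape given by `compRep_snd`, the right side the shape
given by `actRep_snd` followed by `compRep_snd`. -/
theorem eqToHom_comp_of_eq {A A' D E E' : C} (e₁ : A = D) (e₂ : A = A') (e₃ : A' = D) (e₄ : E' = E)
    {f : D ⟶ E} {g : D ⟶ E'} (h : f = g ≫ eqToHom e₄) :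
    eqToHom e₁ ≫ f = eqToHom e₂ ≫ (eqToHom e₃ ≫ g) ≫ eqToHom e₄ := by
  subst e₂ e₃ e₄
  simpa using h

theorem eqToHom_comp_comp {A A₁ A₂ D E F G : C} (e₁ : A = D) (e₂ : A = A₁) (e₃ : A₁ = A₂)
    (e₄ : A₂ = D) (f : D ⟶ E) (g : E ⟶ F) (h : F ⟶ G) :
    eqToHom e₁ ≫ f ≫ g ≫ h =
      eqToHom e₂ ≫ (eqToHom e₃ ≫ (eqToHom e₄ ≫ f ≫ g) ≫ h) ≫ 𝟙 G := by
  subst e₂ e₃ e₄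
  simp

/-- When both permutations induce the same order no pair is inverted, so the orthogonality condition
of `setoid_iff'` is vacuous. Comparing orders avoids comparing permutations assembled from casts and
position bijections. -/
theorem mk_eq_mk {c : Profile C} {t : C} {x y : Equiv.Perm (Fin c.len) × ∀ i, c.col i ⟶ t}
    (hperm : ∀ u v, x.1 u < x.1 v ↔ y.1 u < y.1 v) (hmor : ∀ i, x.2 i = y.2 i) :
    Quotient.mk (O.setoid c t) x = Quotient.mk (O.setoid c t) y := by
  refine Quotient.sound ((O.setoid_iff' x y).mpr ⟨funext hmor, fun u v h h' => ?_⟩)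
  exact absurd ((hperm u v).mp h) (lt_asymm h')

theorem act_mk {c d : Profile C} {t t' : C} (s : c ⟶ d) (h : t = t')
    (x : Equiv.Perm (Fin c.len) × ∀ i, c.col i ⟶ t) :
    O.act s h (Quotient.mk (O.setoid c t) x) = Quotient.mk (O.setoid d t') (actRep s h x) :=
  rfl

theorem actRep_lt_iff {c d : Profile C} {t t' : C} (s : c ⟶ d) (h : t = t')
    (x : Equiv.Perm (Fin c.len) × ∀ i, c.col i ⟶ t) {u v : Fin d.len} {k l : Fin c.len}
    (hk : s.perm u = k) (hl : s.perm v = l) :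
    (actRep s h x).1 u < (actRep s h x).1 v ↔ x.1 k < x.1 l := by
  subst hk hl
  exact Iff.rfl

theorem actRep_snd {c d : Profile C} {t t' : C} (s : c ⟶ d) (h : t = t')
    (x : Equiv.Perm (Fin c.len) × ∀ i, c.col i ⟶ t) {i : Fin d.len} {k : Fin c.len}
    (hk : s.perm i = k) :
    (actRep s h x).2 i =
      eqToHom ((s.col_perm i).symm.trans (congrArg c.col hk)) ≫ x.2 k ≫ eqToHom h := by
  subst hk
  rfl

/-! ### Order and morphisms of a composite. -/

section Comp

variable {t : C} {a : Profile C} {b : Fin a.len → Profile C}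
  (x : Equiv.Perm (Fin a.len) × ∀ i, a.col i ⟶ t)
  (y : ∀ i, Equiv.Perm (Fin (b i).len) × ∀ j, (b i).col j ⟶ a.col i)

theorem compRep_lt_iff (p q : (i : Fin a.len) × Fin (b i).len) :
    (compRep x y).1 (Profile.concatPos b p) < (compRep x y).1 (Profile.concatPos b q) ↔
      x.1 p.1 < x.1 q.1 ∨ (p.1 = q.1 ∧ ((y p.1).1 p.2 : ℕ) < (y q.1).1 q.2) :=
  compPerm_lt_iff _ _ _ _ _

theorem compRep_snd (p : (i : Fin a.len) × Fin (b i).len) :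
    (compRep x y).2 (Profile.concatPos b p) =
      eqToHom (Profile.concat_col b p) ≫ (y p.1).2 p.2 ≫ x.2 p.1 := by
  -- The types depend on the pair `finSigmaFinEquiv.symm k`; with `k` arbitrary, the equation `h`
  -- can be eliminated by substitution.
  have key : ∀ (k : Fin (∑ i, (b i).len)) (h : finSigmaFinEquiv.symm k = p),
      (compRep x y).2 k =
        eqToHom (congrArg (fun p => (b p.1).col p.2) h) ≫ (y p.1).2 p.2 ≫ x.2 p.1 := by
    rintro k rfl
    exact (Category.id_comp _).symm
  exact key _ (Equiv.symm_apply_apply _ _)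

/-- Lexicographic order on triples is independent of the bracketing `((i, j), l)` or `(i, (j, l))`;
this is the combinatorial content of associativity. -/
theorem compRep_compRep_lt_iff {c : ∀ i, Fin (b i).len → Profile C}
    (z : ∀ i j, Equiv.Perm (Fin (c i j).len) × ∀ l, (c i j).col l ⟶ (b i).col j)
    (p q : (i : Fin a.len) × Fin (b i).len) (l : Fin (c p.1 p.2).len) (l' : Fin (c q.1 q.2).len) :
    (x.1 p.1 < x.1 q.1 ∨ (p.1 = q.1 ∧ ((y p.1).1 p.2 : ℕ) < (y q.1).1 q.2)) ∨
        (p = q ∧ ((z p.1 p.2).1 l : ℕ) < (z q.1 q.2).1 l') ↔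
      x.1 p.1 < x.1 q.1 ∨ (p.1 = q.1 ∧
        ((compRep (y p.1) (z p.1)).1 (Profile.concatPos (c p.1) ⟨p.2, l⟩) : ℕ) <
          (compRep (y q.1) (z q.1)).1 (Profile.concatPos (c q.1) ⟨q.2, l'⟩)) := by
  obtain ⟨i, j⟩ := p
  obtain ⟨i', j'⟩ := q
  rw [or_assoc]
  refine or_congr Iff.rfl ?_
  -- For distinct outer blocks both remaining alternatives are impossible; within one block the
  -- claim is the description of the inner composite.
  by_cases hi : i = i'
  · subst hi
    have h := compRep_lt_iff (y i) (z i) ⟨j, l⟩ ⟨j', l'⟩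
    simpa using h.symm
  · simp [hi]

end Comp

/-! ### The operad axioms for the sets of classes. -/

theorem exists_rep_family {n : ℕ} {b : Fin n → Profile C} {t : Fin n → C}
    (y : ∀ i, O.Op (b i) (t i)) :
    ∃ y' : ∀ i, Equiv.Perm (Fin (b i).len) × ∀ j, (b i).col j ⟶ t i,
      (fun i => Quotient.mk (O.setoid (b i) (t i)) (y' i)) = y := by
  choose y' hy' using fun i => Quotient.exists_rep (y i)
  exact ⟨y', funext hy'⟩

theorem comp_act_inner {t : C} {a : Profile C} {b b' : Fin a.len → Profile C}
    (τ : ∀ i, b i ⟶ b' i) (x : O.Op a t) (y : ∀ i, O.Op (b i) (a.col i)) :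
    O.comp x (fun i => O.act (τ i) rfl (y i)) = O.act (Profile.blockSum τ) rfl (O.comp x y) := by
  obtain ⟨x, rfl⟩ := Quotient.exists_rep x
  obtain ⟨y, rfl⟩ := O.exists_rep_family y
  refine (O.comp_mk x fun i => actRep (τ i) rfl (y i)).trans ?_
  rw [O.comp_mk x y, act_mk]
  have hp : ∀ p : (i : Fin a.len) × Fin (b' i).len,
      (Profile.blockSum τ).perm (Profile.concatPos b' p) =
        Profile.concatPos b ⟨p.1, (τ p.1).perm p.2⟩ :=
    fun p => Profile.concatHom_perm _ _ _ _ p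
  refine O.mk_eq_mk (fun u v => ?_) fun k => ?_
  · obtain ⟨p, rfl⟩ := (Profile.concatPos _).surjective u
    obtain ⟨q, rfl⟩ := (Profile.concatPos _).surjective v
    rw [actRep_lt_iff _ _ _ (hp p) (hp q)]
    refine (compRep_lt_iff _ _ p q).trans (Iff.trans ?_ (compRep_lt_iff _ _ _ _).symm)
    exact Iff.rfl
  · obtain ⟨p, rfl⟩ := (Profile.concatPos _).surjective k
    rw [actRep_snd _ _ _ (hp p)]
    refine (compRep_snd _ _ p).trans ?_
    rw [compRep_snd, actRep_snd _ _ _ rfl]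
    simp only [eqToHom_refl, Category.assoc, Category.comp_id]
    rw [eqToHom_trans_assoc]
    exact eqToHom_comp_of_eq _ _ _ rfl (Category.comp_id _).symm

theorem comp_act_outer {t : C} {a a' : Profile C} (σ : a ⟶ a') (b : Fin a.len → Profile C)
    (x : O.Op a t) (y : ∀ i, O.Op (b i) (a.col i)) :
    O.comp (O.act σ rfl x)
        (fun i => O.act (𝟙 (b (σ.perm i))) (σ.col_perm i) (y (σ.perm i))) =
      O.act (Profile.blockPerm b σ.perm) rfl (O.comp x y) := by
  obtain ⟨x, rfl⟩ := Quotient.exists_rep x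
  obtain ⟨y, rfl⟩ := O.exists_rep_family y
  refine (O.comp_mk (actRep σ rfl x)
    fun i => actRep (𝟙 (b (σ.perm i))) (σ.col_perm i) (y (σ.perm i))).trans ?_
  rw [O.comp_mk x y, act_mk]
  have hp : ∀ p : (i : Fin a'.len) × Fin (b (σ.perm i)).len,
      (Profile.blockPerm b σ.perm).perm (Profile.concatPos (fun i => b (σ.perm i)) p) =
        Profile.concatPos b ⟨σ.perm p.1, p.2⟩ :=
    fun p => Profile.concatHom_perm _ _ _ _ p
  refine O.mk_eq_mk (fun u v => ?_) fun k => ?_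
  · obtain ⟨p, rfl⟩ := (Profile.concatPos _).surjective u
    obtain ⟨q, rfl⟩ := (Profile.concatPos _).surjective v
    rw [actRep_lt_iff _ _ _ (hp p) (hp q)]
    refine (compRep_lt_iff _ _ p q).trans (Iff.trans ?_ (compRep_lt_iff _ _ _ _).symm)
    -- Lying in the same block is unaffected by relabelling blocks along the injective `σ`.
    exact or_congr Iff.rfl (and_congr σ.perm.injective.eq_iff.symm Iff.rfl)
  · obtain ⟨p, rfl⟩ := (Profile.concatPos _).surjective k
    rw [actRep_snd _ _ _ (hp p)]
    refine (compRep_snd _ _ p).trans ?_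
    rw [compRep_snd, actRep_snd σ _ _ rfl]
    rw [actRep_snd (𝟙 (b (σ.perm p.1))) _ _ (k := p.2) rfl]
    refine eqToHom_comp_of_eq _ _ _ rfl ?_
    simp

/-- The representative `r` is kept abstract, known only through its order and its morphisms, because
`(Profile.single t).len` is `1` only after unfolding. -/
theorem act_concatOne_mk {t : C} {c : Profile C}
    {x : Equiv.Perm (Fin c.len) × ∀ i, c.col i ⟶ t}
    {r : Equiv.Perm (Fin (Profile.concat (m := (Profile.single t).len) fun _ => c).len) ×
      ∀ i, (Profile.concat (m := (Profile.single t).len) fun _ => c).col i ⟶ t}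
    (hperm : ∀ u v : Fin c.len,
      r.1 (Profile.concatPos (m := (Profile.single t).len) (fun _ => c) ⟨(0 : Fin 1), u⟩) <
        r.1 (Profile.concatPos (m := (Profile.single t).len) (fun _ => c) ⟨(0 : Fin 1), v⟩) ↔
      x.1 u < x.1 v)
    (hmor : ∀ i : Fin c.len,
      r.2 (Profile.concatPos (m := (Profile.single t).len) (fun _ => c) ⟨(0 : Fin 1), i⟩) =
        eqToHom (Profile.concat_col (m := (Profile.single t).len) (fun _ => c)
          ⟨(0 : Fin 1), i⟩) ≫ x.2 i) :
    O.act (Profile.concatOne c) rfl (Quotient.mk (O.setoid _ t) r) =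
      Quotient.mk (O.setoid c t) x := by
  have hp : ∀ i : Fin c.len, (Profile.concatOne c).perm i =
      Profile.concatPos (fun _ : Fin 1 => c) ⟨0, i⟩ := fun i => rfl
  refine O.mk_eq_mk (fun u v => ?_) fun i => ?_
  · exact (actRep_lt_iff (Profile.concatOne c) rfl r (hp u) (hp v)).trans (hperm u v)
  · refine (actRep_snd (Profile.concatOne c) rfl r (hp i)).trans ?_
    refine (congrArg (fun f => eqToHom _ ≫ f ≫ eqToHom _) (hmor i)).trans ?_
    exact ((Category.id_comp _).symm.trans (eqToHom_comp_of_eq rfl _ _ rfl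
      (Category.comp_id _).symm)).symm

theorem unit_comp (t : C) (c : Profile C) (x : O.Op c t) :
    O.act (Profile.concatOne c) rfl
      (O.comp (a := Profile.single t) (b := fun _ => c) (O.cls 1 fun _ => 𝟙 t) fun _ => x) = x := by
  obtain ⟨x, rfl⟩ := Quotient.exists_rep x
  let e : Equiv.Perm (Fin (Profile.single t).len) × ∀ i, (Profile.single t).col i ⟶ t :=
    (1, fun _ => 𝟙 t)
  refine (congrArg (O.act (Profile.concatOne c) rfl)
    (O.comp_mk (a := Profile.single t) (b := fun _ => c) e fun _ => x)).trans ?_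
  have h₁ := compRep_lt_iff (a := Profile.single t) (b := fun _ => c) e (fun _ => x)
  have h₂ := compRep_snd (a := Profile.single t) (b := fun _ => c) e (fun _ => x)
  generalize compRep (a := Profile.single t) (b := fun _ => c) e (fun _ => x) = r at h₁ h₂ ⊢
  refine O.act_concatOne_mk (fun u v => (h₁ _ _).trans ?_) fun i => (h₂ _).trans ?_
  · exact (or_iff_right (lt_irrefl _)).trans (and_iff_right rfl)
  · exact congrArg (eqToHom _ ≫ ·) (Category.comp_id (x.2 i))

theorem comp_unit (t : C) (c : Profile C) (x : O.Op c t) :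
    O.act (Profile.concatSingle c) rfl
      (O.comp (b := fun i => Profile.single (c.col i)) x
        fun i => O.cls 1 fun _ => 𝟙 (c.col i)) = x := by
  obtain ⟨x, rfl⟩ := Quotient.exists_rep x
  refine (congrArg (O.act _ rfl) (O.comp_mk (b := fun i => Profile.single (c.col i)) x
    fun i => (1, fun _ => 𝟙 (c.col i)))).trans ?_
  have hp : ∀ i : Fin c.len, (Profile.concatSingle c).perm i =
      Profile.concatPos (fun i => Profile.single (c.col i)) ⟨i, (0 : Fin 1)⟩ := fun i => rfl
  refine O.mk_eq_mk (fun u v => ?_) fun i => ?_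
  · refine (actRep_lt_iff _ _ _ (hp _) (hp _)).trans ?_
    refine (compRep_lt_iff _ _ _ _).trans ?_
    -- Every block has a single entry, so ties between blocks never produce a strict comparison.
    exact or_iff_left fun h => lt_irrefl _ h.2
  · rw [actRep_snd _ _ _ (hp i)]
    rw [compRep_snd]
    exact ((Category.id_comp _).symm.trans (eqToHom_comp_of_eq rfl _ _ rfl
      ((Category.comp_id _).trans (Category.id_comp _)).symm)).symm

theorem comp_assoc {t : C} {a : Profile C} {b : Fin a.len → Profile C}
    (c : ∀ i, Fin (b i).len → Profile C) (x : O.Op a t) (y : ∀ i, O.Op (b i) (a.col i))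
    (z : ∀ i j, O.Op (c i j) ((b i).col j)) :
    O.comp (O.comp x y) (fun k => z (finSigmaFinEquiv.symm k).1 (finSigmaFinEquiv.symm k).2) =
      O.act (Profile.concatAssoc b c) rfl (O.comp x fun i => O.comp (y i) (z i)) := by
  obtain ⟨x, rfl⟩ := Quotient.exists_rep x
  obtain ⟨y, rfl⟩ := O.exists_rep_family y
  obtain ⟨z, rfl⟩ : ∃ z' : ∀ i j, Equiv.Perm (Fin (c i j).len) × ∀ l, (c i j).col l ⟶ (b i).col j,
      (fun i j => Quotient.mk (O.setoid (c i j) ((b i).col j)) (z' i j)) = z := by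
    choose z' hz' using fun i => O.exists_rep_family (z i)
    exact ⟨z', funext hz'⟩
  simp only [O.comp_mk]
  refine (O.comp_mk _ _).trans ?_
  rw [act_mk]
  have hp : ∀ p, (Profile.concatAssoc b c).perm (Profile.concatPos _ p) =
      Profile.concatPos (fun i => Profile.concat (c i)) ⟨((Profile.concatPos b).symm p.1).1,
        Profile.concatPos (c ((Profile.concatPos b).symm p.1).1)
          ⟨((Profile.concatPos b).symm p.1).2, p.2⟩⟩ :=
    fun p => Profile.concatHom_perm _ _ _ _ p
  refine O.mk_eq_mk (fun u v => ?_) fun k => ?_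
  · obtain ⟨⟨p, l⟩, rfl⟩ := (Profile.concatPos _).surjective u
    obtain ⟨⟨q, l'⟩, rfl⟩ := (Profile.concatPos _).surjective v
    refine (compRep_lt_iff _ _ _ _).trans (Iff.trans ?_
      ((actRep_lt_iff _ _ _ (hp _) (hp _)).trans (compRep_lt_iff _ _ _ _)).symm)
    -- The outer comparison in the twofold composite is itself lexicographic, in the pairs numbered
    -- by `p` and `q`.
    have h := compRep_lt_iff x y ((Profile.concatPos b).symm p) ((Profile.concatPos b).symm q)
    rw [Equiv.apply_symm_apply, Equiv.apply_symm_apply] at h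
    refine (or_congr h (and_congr (Profile.concatPos b).symm.injective.eq_iff.symm
      Iff.rfl)).trans ?_
    exact compRep_compRep_lt_iff x y z _ _ l l'
  · obtain ⟨p, rfl⟩ := (Profile.concatPos _).surjective k
    refine (compRep_snd _ _ p).trans (Eq.trans ?_ (actRep_snd _ _ _ (hp p)).symm)
    rw [compRep_snd, compRep_snd]
    exact eqToHom_comp_comp _ _ _ _ _ _ _

/-- The reverse of a lexicographic order is the lexicographic order of the reversed block order and
the reversed orders inside the blocks. -/
theorem rev_comp {t : C} {a : Profile C} {b : Fin a.len → Profile C} (x : O.Op a t)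
    (y : ∀ i, O.Op (b i) (a.col i)) :
    O.rev (O.comp x y) = O.comp (O.rev x) fun i => O.rev (y i) := by
  obtain ⟨x, rfl⟩ := Quotient.exists_rep x
  obtain ⟨y, rfl⟩ := O.exists_rep_family y
  rw [O.comp_mk]
  refine Eq.trans ?_ (O.comp_mk (Fin.revPerm * x.1, x.2)
    fun i => (Fin.revPerm * (y i).1, (y i).2)).symm
  refine O.mk_eq_mk (fun u v => ?_) fun _ => rfl
  obtain ⟨p, rfl⟩ := (Profile.concatPos _).surjective u
  obtain ⟨q, rfl⟩ := (Profile.concatPos _).surjective v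
  refine Iff.trans ?_ (compRep_lt_iff _ _ _ _).symm
  refine Fin.rev_lt_rev.trans ((compRep_lt_iff _ _ _ _).trans ?_)
  refine or_congr Fin.rev_lt_rev.symm ?_
  obtain ⟨i, j⟩ := p
  obtain ⟨i', j'⟩ := q
  -- Reversal has exchanged the two positions, so the equality of their blocks appears flipped.
  rw [eq_comm]
  refine and_congr_right fun h => ?_
  obtain rfl : i = i' := h
  exact (Fin.rev_lt_rev (i := (y i).1 j) (j := (y i).1 j')).symm

theorem rev_rev {t : C} {c : Profile C} (x : O.Op c t) : O.rev (O.rev x) = x := by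
  obtain ⟨x, rfl⟩ := Quotient.exists_rep x
  refine O.mk_eq_mk (fun u v => ?_) fun _ => rfl
  exact Fin.rev_lt_rev.trans Fin.rev_lt_rev

theorem rev_unit (t : C) :
    O.rev (O.cls (c := Profile.single t) 1 fun _ => 𝟙 t) = O.cls 1 fun _ => 𝟙 t := by
  refine O.mk_eq_mk (fun (u v : Fin 1) => ?_) fun _ => rfl
  obtain rfl : u = v := Subsingleton.elim _ _
  exact iff_of_false (lt_irrefl _) (lt_irrefl _)

end Orthogonality

/-! ### Jointly epic families of points -/

section JointlyEpic

variable {M : Type u} [Category.{v} M] [MonoidalCategory M]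

/-- A family of points of `A` such that morphisms out of `A` are determined by their values on
these points. -/
def JointlyEpic {S : Type w} {A : M} (p : S → (𝟙_ M ⟶ A)) : Prop :=
  ∀ ⦃Z : M⦄ (f g : A ⟶ Z), (∀ s, p s ≫ f = p s ≫ g) → f = g

/-- Currying turns a morphism out of `A ⊗ B` into one out of `B`, which the points `q` detect.
Uncurrying at a fixed `q t` leaves a morphism out of `A ⊗ I ≅ A`, which the points `p` detect. -/
theorem JointlyEpic.pointPair [MonoidalClosed M] {S : Type*} {T : Type*} {A B : M}
    {p : S → (𝟙_ M ⟶ A)} {q : T → (𝟙_ M ⟶ B)} (hp : JointlyEpic p) (hq : JointlyEpic q) :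
    JointlyEpic fun x : S × T => AQFT.pointPair (p x.1) (q x.2) := by
  intro Z f g h
  refine MonoidalClosed.curry_injective (hq _ _ fun t => ?_)
  rw [← MonoidalClosed.curry_natural_left, ← MonoidalClosed.curry_natural_left]
  congr 1
  rw [← cancel_epi (ρ_ A).inv]
  refine hp _ _ fun s => ?_
  have e : p s ≫ (ρ_ A).inv ≫ (A ◁ q t) = AQFT.pointPair (p s) (q t) := by
    rw [← Category.assoc, ← pointPair_id_right, pointPair_whiskerLeft, Category.id_comp]
  have h' := h (s, t)
  dsimp only at h'
  rw [← e] at h'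
  simpa using h'

theorem JointlyEpic.tensorFinPoint [MonoidalClosed M] : (n : ℕ) → {S : Fin n → Type w} →
    {X : Fin n → M} → {p : ∀ i, S i → (𝟙_ M ⟶ X i)} → (∀ i, JointlyEpic (p i)) →
    JointlyEpic fun x : ∀ i, S i => AQFT.tensorFinPoint n fun i => p i (x i)
  | 0, S, X, p, _, Z, f, g, h => by
    -- The empty tensor product is `I`, and its only point in the family is the identity.
    have h' := h fun i => i.elim0
    dsimp only at h'
    rw [tensorFinPoint_zero] at h'
    exact (Category.id_comp _).symm.trans (h'.trans (Category.id_comp _))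
  | n + 1, S, X, p, hp, Z, f, g, h => by
    refine JointlyEpic.pointPair (hp 0) (JointlyEpic.tensorFinPoint n fun i => hp i.succ) _ _
      fun ⟨s, x⟩ => ?_
    have h' := h (Fin.cons s x)
    dsimp only at h'
    rw [tensorFinPoint_succ] at h'
    exact h'

end JointlyEpic

/-! ### Points under a lax monoidal functor. -/

section Lax

variable {M : Type u} [Category.{v} M] [MonoidalCategory M]

theorem tensorFinPoint_J (J : M ⥤ M) [J.LaxMonoidal] : (n : ℕ) → {X : Fin n → M} →
    (u : ∀ i, 𝟙_ M ⟶ X i) →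
    tensorFinPoint n (fun i => Functor.LaxMonoidal.ε J ≫ J.map (u i)) ≫ tensorFinJ J n X =
      Functor.LaxMonoidal.ε J ≫ J.map (tensorFinPoint n u)
  | 0, X, u => by
    rw [tensorFinPoint_zero, tensorFinPoint_zero]
    simp only [tensorFinJ]
    refine (Category.id_comp _).trans ?_
    exact ((congrArg _ (J.map_id _)).trans (Category.comp_id _)).symm
  | n + 1, X, u => by
    rw [tensorFinPoint_succ, tensorFinPoint_succ]
    simp only [tensorFinJ]
    refine (Category.assoc _ _ _).symm.trans
      ((congrArg (· ≫ _) (pointPair_whiskerLeft _ _ _)).trans ?_)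
    rw [tensorFinPoint_J J n fun i => u i.succ]
    exact pointPair_μ J _ _

end Lax

/-! ### The AQFT operad is a `*`-operad -/

namespace Orthogonality

variable {C : Type w} [Category.{w} C] (O : Orthogonality C)
  {M : Type u} [Category.{v} M] [MonoidalCategory M] [HasCoproducts.{w} M]

theorem jointlyEpic_ι (c : Profile C) (t : C) :
    JointlyEpic (A := (O.symSeq M).val t c) fun x : O.Op c t => O.ι M x :=
  fun _ _ _ h => Sigma.hom_ext _ _ h

theorem ι_act {c d : Profile C} (t : C) (s : c ⟶ d) (x : O.Op c t) :
    O.ι M x ≫ (O.symSeq M).act t s = O.ι M (O.act s rfl x) :=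
  O.ι_map (p := (c, Discrete.mk t)) (q := (d, Discrete.mk t))
    (Prod.mkHom s (𝟙 (Discrete.mk t))) x

/-- Treating a change of color as an action by the identity permutation puts it in the form used by
`comp_act_outer`. -/
theorem ι_castCol {c : Profile C} {s t : C} (h : s = t) (x : O.Op c s) :
    O.ι M x ≫ (O.symSeq M).castCol h c = O.ι M (O.act (𝟙 c) h x) := by
  subst h
  rw [O.act_id]
  exact Category.comp_id _

/-! ### The involution on points. -/

section Star

variable [SymmetricCategory M] (Inv : Involution M)

theorem ι_star {c : Profile C} {t : C} (x : O.Op c t) :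
    O.ι M x ≫ (O.star Inv).app (c, Discrete.mk t) =
      Functor.LaxMonoidal.ε Inv.J ≫ Inv.J.map (O.ι M (O.rev x)) :=
  Sigma.ι_desc _ _

/-- On the point `ι x` both sides equal `ε ≫ J ε ≫ J (J (ι x))`: the left one because reversing
twice is trivial, the right one by naturality of `j` and monoidality, which makes `j` at `I` the
unit of `J ⋙ J`. -/
theorem star_star :
    O.star Inv ≫ Inv.JStar.map (O.star Inv) = Inv.jStar.hom.app (O.symSeq M) := by
  ext ⟨c, ⟨t⟩⟩
  refine O.jointlyEpic_ι c t _ _ fun x => ?_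
  have h : O.ι M x ≫ Inv.j.hom.app ((O.symSeq M).val t c) =
      Functor.LaxMonoidal.ε Inv.J ≫ Inv.J.map (Functor.LaxMonoidal.ε Inv.J) ≫
        Inv.J.map (Inv.J.map (O.ι M x)) := by
    have h₁ := Inv.j.hom.naturality (O.ι M x)
    have h₂ := NatTrans.IsMonoidal.unit (τ := Inv.j.hom)
    rw [Functor.LaxMonoidal.comp_ε] at h₂
    refine h₁.trans ?_
    rw [← Category.assoc, ← h₂]
    congr 1
    exact (Category.id_comp _).symm
  refine Eq.trans ?_ h.symm
  refine (Category.assoc _ _ _).symm.trans ((congrArg (· ≫ _) (O.ι_star Inv x)).trans ?_)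
  refine (Category.assoc _ _ _).trans (congrArg _ ?_)
  refine (Inv.J.map_comp _ _).symm.trans ?_
  rw [← Functor.map_comp]
  congr 1
  have h' := O.ι_star Inv (O.rev x)
  rw [O.rev_rev] at h'
  exact h'

end Star

/-! ### Operad and `*`-operad axioms tested on points. -/

section Closed

variable [MonoidalClosed M]

theorem jointlyEpic_tensorFin_ι {n : ℕ} (b : Fin n → Profile C) (t : Fin n → C) :
    JointlyEpic fun y : ∀ i, O.Op (b i) (t i) => tensorFinPoint n fun i => O.ι M (y i) :=
  JointlyEpic.tensorFinPoint n fun i => O.jointlyEpic_ι (b i) (t i)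

variable [SymmetricCategory M]

theorem pointPair_ι_comp {t : C} {a : Profile C} {b : Fin a.len → Profile C}
    (x : O.Op a t) (y : ∀ i, O.Op (b i) (a.col i)) :
    pointPair (O.ι M x) (tensorFinPoint a.len fun i => O.ι M (y i)) ≫ (O.operad M).comp t a b =
      O.ι M (O.comp x y) := by
  refine (Category.assoc _ _ _).trans ((congrArg _ (O.ι_operad_comp M x y)).trans ?_)
  rw [← unitors_equal, Iso.inv_hom_id_assoc]

theorem isOperad : (O.operad M).IsOperad where
  equivariant_inner t a b b' τ := by
    refine JointlyEpic.pointPair (O.jointlyEpic_ι a t) (O.jointlyEpic_tensorFin_ι b a.col) _ _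
      fun ⟨x, y⟩ => ?_
    dsimp only
    rw [← Category.assoc, ← Category.assoc, pointPair_whiskerLeft, tensorFinPoint_map,
      pointPair_ι_comp, ι_act, ← comp_act_inner, ← pointPair_ι_comp]
    simp only [ι_act]
  equivariant_outer t a a' σ b := by
    refine JointlyEpic.pointPair (O.jointlyEpic_ι a t) (O.jointlyEpic_tensorFin_ι b a.col) _ _
      fun ⟨x, y⟩ => ?_
    dsimp only
    rw [← Category.assoc, ← Category.assoc, pointPair_tensorHom, ← Category.assoc,
      tensorFinPoint_perm a'.len a.len (fun i => O.ι M (y i)), tensorFinPoint_map,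
      pointPair_ι_comp, ι_act, ι_act, ← comp_act_outer, ← pointPair_ι_comp]
    simp only [ι_castCol]
  unit_comp t c := by
    refine O.jointlyEpic_ι c t _ _ fun x => ?_
    refine Eq.trans ?_ (Category.comp_id _).symm
    have h := O.pointPair_ι_comp (M := M) (a := Profile.single t) (b := fun _ => c)
      (O.cls 1 fun _ => 𝟙 t) fun _ => x
    -- A one-fold `tensorFin` still ends in a factor `I`; the inverse right unitor supplies it.
    have e : O.ι M x ≫ (λ_ ((O.symSeq M).val t c)).inv ≫
        ((O.operad M).unit t ⊗ₘ (ρ_ ((O.symSeq M).val t c)).inv) =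
        pointPair ((O.operad M).unit t) (tensorFinPoint 1 fun _ => O.ι M x) := by
      rw [← Category.assoc, ← pointPair_id_left, pointPair_tensorHom, Category.id_comp,
        tensorFinPoint_succ, tensorFinPoint_zero, ← pointPair_id_right]
      rfl
    have h' := O.ι_act (M := M) t (Profile.concatOne c) (O.comp (a := Profile.single t)
      (b := fun _ => c) (O.cls 1 fun _ => 𝟙 t) fun _ => x)
    rw [O.unit_comp] at h'
    refine Eq.trans ?_ ((congrArg (· ≫ _) h).trans h')
    refine Eq.trans ?_ (congrArg (fun f => (f ≫ _) ≫ _) e)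
    exact ((Category.assoc _ _ _).trans ((Category.assoc _ _ _).trans
      (congrArg _ (Category.assoc _ _ _)))).symm
  comp_unit t c := by
    refine O.jointlyEpic_ι c t _ _ fun x => ?_
    refine Eq.trans ?_ (Category.comp_id _).symm
    rw [← Category.assoc, ← pointPair_id_right, ← Category.assoc, pointPair_whiskerLeft,
      Category.id_comp, ← Category.assoc]
    refine (congrArg (· ≫ _) (O.pointPair_ι_comp (M := M) x
      fun i => O.cls (c := Profile.single (c.col i)) 1 fun _ => 𝟙 (c.col i))).trans ?_
    rw [ι_act, comp_unit]
  assoc t a b c := by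
    -- The test points are triples of an outer operation, a family of middle ones and a doubly
    -- indexed family of inner ones. `hl` and `hr` evaluate the two bracketings on them, and
    -- `comp_assoc` identifies the results.
    refine JointlyEpic.pointPair (O.jointlyEpic_ι a t) (JointlyEpic.pointPair
      (O.jointlyEpic_tensorFin_ι b a.col) (JointlyEpic.tensorFinPoint a.len fun i =>
        O.jointlyEpic_tensorFin_ι (c i) (b i).col)) _ _ fun ⟨x, y, z⟩ => ?_
    dsimp only
    have hl := (congrArg (· ≫ _) (pointPair_associator_inv (O.ι M x)
      (tensorFinPoint a.len fun i => O.ι M (y i))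
      (tensorFinPoint a.len fun i => tensorFinPoint (b i).len fun j => O.ι M (z i j)))).trans
      ((pointPair_tensorHom _ _ _ _).trans (congrArg₂ pointPair (O.pointPair_ι_comp x y)
        (tensorFinPoint_flatten a.len (fun i => (b i).len) _ fun x => O.ι M (z x.1 x.2))))
    have hr : pointPair (O.ι M x) (pointPair (tensorFinPoint a.len fun i => O.ι M (y i))
        (tensorFinPoint a.len fun i => tensorFinPoint (b i).len fun j => O.ι M (z i j))) ≫
        ((O.symSeq M).val t a ◁
          (tensorFinInterleave a.len (fun i => (O.symSeq M).val (a.col i) (b i))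
            (fun i => tensorFin (b i).len fun j => (O.symSeq M).val ((b i).col j) (c i j)) ≫
          tensorFinMap a.len fun i => (O.operad M).comp (a.col i) (b i) (c i))) =
        pointPair (O.ι M x) (tensorFinPoint a.len fun i => O.ι M (O.comp (y i) (z i))) := by
      rw [pointPair_whiskerLeft, ← Category.assoc, tensorFinPoint_interleave, tensorFinPoint_map]
      simp only [pointPair_ι_comp]
    refine Eq.trans ?_ (Category.assoc _ _ _)
    have hc : (pointPair (O.ι M x)
        (tensorFinPoint a.len fun i => O.ι M (O.comp (y i) (z i))) ≫
          (O.operad M).comp t a fun i => Profile.concat (c i)) ≫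
        (O.symSeq M).act t (Profile.concatAssoc b c) = O.ι M (O.comp (O.comp x y) fun k =>
          z (finSigmaFinEquiv.symm k).1 (finSigmaFinEquiv.symm k).2) := by
      rw [pointPair_ι_comp, ι_act, comp_assoc]
    refine Eq.trans ?_ (congrArg (· ≫ _) hr.symm)
    refine Eq.trans ?_ (hc.symm.trans (Category.assoc _ _ _))
    refine Eq.trans ?_ ((congrArg (· ≫ _) hl).trans (O.pointPair_ι_comp _ _))
    exact ((Category.assoc _ _ _).trans (Category.assoc _ _ _)).symm

/-- On points `*` is reversal followed by `p ↦ ε ≫ J p`. The latter is multiplicative by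
`tensorFinPoint_J` and `pointPair_μ`, so only `rev_unit` and `rev_comp` are left for units and
compositions. -/
theorem isStarOperad (Inv : Involution M) : (O.operad M).IsStarOperad Inv (O.star Inv) where
  isOperad := O.isOperad
  star_star := O.star_star Inv
  unit_star t := by
    refine (O.ι_star Inv _).trans ?_
    rw [O.rev_unit]
    rfl
  comp_star t a b := by
    refine JointlyEpic.pointPair (O.jointlyEpic_ι a t) (O.jointlyEpic_tensorFin_ι b a.col) _ _
      fun ⟨x, y⟩ => ?_
    dsimp only
    rw [← Category.assoc, pointPair_ι_comp, ι_star, rev_comp]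
    refine Eq.trans ?_ (Category.assoc _ _ _)
    refine Eq.trans ?_ (congrArg (· ≫ _) (pointPair_tensorHom _ _ _ _).symm)
    rw [tensorFinPoint_map]
    simp only [ι_star]
    rw [← Category.assoc, ← Category.assoc]
    refine Eq.trans ?_ (congrArg (fun f => (f ≫ _) ≫ _) (pointPair_whiskerLeft _ _ _).symm)
    rw [tensorFinPoint_J, pointPair_μ, Category.assoc, ← Functor.map_comp, pointPair_ι_comp]

end Closed

end Orthogonality

end AQFT

theorem proposition7p6 {M : Type u} [Category.{v} M] [MonoidalCategory M] [SymmetricCategory M]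
    [MonoidalClosed M] [HasColimitsOfSize.{w, w} M] (Inv : AQFT.Involution M)
    {C : Type w} [SmallCategory C] (O : AQFT.Orthogonality C) :
    (O.operad M).IsStarOperad Inv (O.star Inv) :=
  O.isStarOperad Inv
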